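/- **Theorem (Nominal Eilenberg Theorem).** Fix a countably infinite set $\mathbb{A}$ of atoms. Varieties of data languages and pseudovarieties of nominal monoids, both ordered by inclusion, form isomorphic complete lattices. The isomorphism maps a variety $\mathcal V$ to the pseudovariety of all orbit-finite nominal monoids $M$ such that, for every orbit-finite strong nominal set $\Sigma$, every data language over $\Sigma$ recognized by $M$ lies in $\mathcal V_\Sigma$. Its inverse maps a pseudovariety $\mathscr V$ to the variety whose component at $\Sigma$ consists of all data languages over $\Sigma$ recognized by some monoid in $\mathscr V$. Here the following definitions are used. *Nominal sets.* $\mathrm{Perm}(\mathbb A)$ is the group of bijections of $\mathbb{A}$ that move only finitely many atoms, and $\mathrm{Perm}_S(\mathbb A)$ is the subgroup of those fixing every element of $S\subseteq\mathbb A$. An element $x$ of a $\mathrm{Perm}(\mathbb{A})$-set is supported by $S$ if $\pi\cdot x=x$ for all $\pi\in\mathrm{Perm}_S(\mathbb A)$. A nominal set is a $\mathrm{Perm}(\mathbb A)$-set in which every element $x$ has a finite support, and hence a least finite support $\mathsf{supp}(x)$. It is strong if $\pi\cdot x=x$ holds if and only if $\pi$ fixes every atom in $\mathsf{supp}(x)$,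 and orbit-finite if it has finitely many orbits. Subsets carry the action $\pi\cdot X_0=\{\pi\cdot x: x\in X_0\}$. Equivariant maps are those commuting with the action. *Nominal monoids.* A nominal monoid is a nominal set with a monoid structure whose multiplication is equivariant and whose unit is fixed by $\mathrm{Perm}(\mathbb A)$. The set $\Sigma^*$ of words over a nominal set $\Sigma$, with the letterwise action, is an example. A pseudovariety of nominal monoids is a nonempty class of orbit-finite nominal monoids closed under binary products, submonoids (domains of injective equivariant monoid morphisms into members) and quotients (codomains of surjective equivariant monoid morphisms from members). *Data languages.* A data language over $\Sigma$ is a finitely supported subset $L\subseteq \Sigma^*$. It is recognized by a nominal monoid $M$ if $L=e^{-1}[P]$ for some equivariant monoid morphism $e\colon\Sigma^*\to M$ and some finitely supported subset $P\subseteq M$, and it is recognizable if it is recognized by some orbit-finite nominal monoid. *Local varieties.* A local variety over $\Sigma$ is a set of recognizable data languages over $\Sigma$ that is closed under the action of $\mathrm{Perm}(\mathbb A)$, under the set-theoretic boolean operations (including $\emptyset$ and $\Sigma^*$), under $L\mapsto \bigcup_{\pi\in\mathrm{Perm}_S(\mathbb A)}\pi\cdot L$ for every finite $S\subseteq\mathbb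 A$, and under the derivatives $w^{-1}L=\{v: wv\in L\}$ and $Lw^{-1}=\{v: vw\in L\}$ for $w\in\Sigma^*$. Its atomic languages are its minimal nonempty members. It is atom-finite if its atomic languages form finitely many orbits and each of its nonempty members contains an atomic language. *Varieties.* A variety of data languages is a family $(\mathcal V_\Sigma)$ of local varieties over $\Sigma$, where $\Sigma$ ranges over all orbit-finite strong nominal sets, with the following two properties. 1. *Closedness under preimages:* for every equivariant monoid morphism $h\colon\Delta^*\to\Sigma^*$ and every $L\in\mathcal V_\Sigma$ one has $h^{-1}[L]\in\mathcal V_\Delta$. 2. *Completeness:* for every $\Sigma$ and every atom-finite local variety $\mathcal V'_\Sigma\subseteq\mathcal V_\Sigma$ there exist an orbit-finite strong nominal set $\Delta$, an equivariant monoid morphism $h\colon\Sigma^*\to\Delta^*$ and an atom-finite local variety $\mathcal V'_\Delta\subseteq\mathcal V_\Delta$ such that $L\mapsto h^{-1}[L]$ is a bijection from $\mathcal V'_\Delta$ onto $\mathcal V'_\Sigma$, and every atomic language $L$ of $\mathcal V'_\Delta$ contains a word $w$ with $\mathsf{supp}(L)=\mathsf{supp}(w)$. The order on varieties is $\mathcal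 V\le\mathcal W$ iff $\mathcal V_\Sigma\subseteq\mathcal W_\Sigma$ for all $\Sigma$. -/

import Mathlib

open scoped Pointwise

universe u

namespace NomEil

section NominalSets

variable (𝔸 : Type u)

/-- The group `Perm(𝔸)` of finite permutations: bijections moving only finitely many atoms. -/
def finPerm : Subgroup (Equiv.Perm 𝔸) where
  carrier := {π | {a | π a ≠ a}.Finite}
  one_mem' := by simp
  mul_mem' := by
    intro π σ hπ hσ
    refine Set.Finite.subset (hπ.union hσ) ?_
    intro a ha
    by_contra h
    have h1 : π a = a := by_contra fun h1 => h (Or.inl h1)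
    have h2 : σ a = a := by_contra fun h2 => h (Or.inr h2)
    exact ha (by simp [h1, h2])
  inv_mem' := by
    intro π hπ
    refine Set.Finite.subset hπ ?_
    intro a ha h
    exact ha (Equiv.Perm.inv_eq_iff_eq.2 h.symm)

/-- Finite permutations of the atoms, acting on the atoms by evaluation. -/
abbrev FinPerm : Type u := ↥(finPerm 𝔸)

/-- `x` is finitely supported: it is fixed by all finite permutations that fix a certain finite
set `S` of atoms. (`MulAction.Supports` is Mathlib's notion of a support.) -/
def FinitelySupported {X : Type u} [SMul (FinPerm 𝔸) X] (x : X) : Prop :=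
  ∃ S : Finset 𝔸, MulAction.Supports (FinPerm 𝔸) (S : Set 𝔸) x

/-- A `Perm(𝔸)`-set is nominal if all its elements are finitely supported. -/
def IsNominal (X : Type u) [SMul (FinPerm 𝔸) X] : Prop :=
  ∀ x : X, FinitelySupported 𝔸 x

/-- The least (finite) support of a finitely supported element: the intersection of all its
finite supports. -/
def supp {X : Type u} [SMul (FinPerm 𝔸) X] (x : X) : Set 𝔸 :=
  {a | ∀ S : Finset 𝔸, MulAction.Supports (FinPerm 𝔸) (S : Set 𝔸) x → a ∈ S}

/-- A subset of a `Perm(𝔸)`-set is orbit-finite if its elements lie in finitely many orbits. -/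
def OrbitFiniteSet {X : Type u} [MulAction (FinPerm 𝔸) X] (T : Set X) : Prop :=
  (MulAction.orbit (FinPerm 𝔸) '' T).Finite

/-- A `Perm(𝔸)`-set is orbit-finite if it has finitely many orbits. -/
def IsOrbitFinite (X : Type u) [MulAction (FinPerm 𝔸) X] : Prop :=
  OrbitFiniteSet 𝔸 (Set.univ : Set X)

/-- A nominal set is strong if the permutations fixing `x` are exactly those fixing every atom
in the least support of `x`. -/
def IsStrong (X : Type u) [SMul (FinPerm 𝔸) X] : Prop :=
  ∀ (x : X) (π : FinPerm 𝔸), π • x = x ↔ ∀ a ∈ supp 𝔸 x, π • a = a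

/-- Equivariant maps. -/
def Equivariant {X Y : Type u} [SMul (FinPerm 𝔸) X] [SMul (FinPerm 𝔸) Y] (f : X → Y) : Prop :=
  ∀ (π : FinPerm 𝔸) (x : X), f (π • x) = π • f x

/-- An orbit-finite strong nominal set. -/
structure Alphabet : Type (u + 1) where
  carrier : Type u
  [action : MulAction (FinPerm 𝔸) carrier]
  nominal : IsNominal 𝔸 carrier
  orbitFinite : IsOrbitFinite 𝔸 carrier
  strong : IsStrong 𝔸 carrier

instance : CoeSort (Alphabet 𝔸) (Type u) := ⟨Alphabet.carrier⟩

attribute [instance] Alphabet.action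

/-- A nominal monoid. The class `MulDistribMulAction` says that `Perm(𝔸)` acts, that the
multiplication is equivariant (`π • (x * y) = π • x * π • y`) and that `π • 1 = 1`. -/
structure NomMonoid : Type (u + 1) where
  carrier : Type u
  [monoid : Monoid carrier]
  [action : MulDistribMulAction (FinPerm 𝔸) carrier]
  nominal : IsNominal 𝔸 carrier

instance : CoeSort (NomMonoid 𝔸) (Type u) := ⟨NomMonoid.carrier⟩

attribute [instance] NomMonoid.monoid NomMonoid.action

variable {𝔸}

/-- The product of two nominal monoids, with componentwise multiplication and action. -/
def NomMonoid.prod (M N : NomMonoid 𝔸) : NomMonoid 𝔸 where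
  carrier := M × N
  nominal := by
    classical
    rintro ⟨m, n⟩
    obtain ⟨S, hS⟩ := M.nominal m
    obtain ⟨T, hT⟩ := N.nominal n
    refine ⟨S ∪ T, fun π hπ => ?_⟩
    ext
    · exact hS π fun a ha => hπ (by simp [Finset.mem_coe.1 ha])
    · exact hT π fun a ha => hπ (by simp [Finset.mem_coe.1 ha])

/-- The letterwise action of `Perm(𝔸)` on the free monoid `X*` of words over `X`. -/
instance freeMonoidAction (X : Type u) [MulAction (FinPerm 𝔸) X] :
    MulDistribMulAction (FinPerm 𝔸) (FreeMonoid X) where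
  smul π w := FreeMonoid.map (π • ·) w
  one_smul w := by
    change FreeMonoid.map (fun x : X => (1 : FinPerm 𝔸) • x) w = w
    simp only [one_smul]
    exact congrFun (congrArg DFunLike.coe (FreeMonoid.map_id (α := X))) w
  mul_smul π σ w := by
    change FreeMonoid.map (fun x : X => (π * σ) • x) w =
      FreeMonoid.map (fun x : X => π • x) (FreeMonoid.map (fun x : X => σ • x) w)
    simp only [mul_smul, FreeMonoid.map_map]
    rfl
  smul_mul π v w := map_mul (FreeMonoid.map (fun x : X => π • x)) v w
  smul_one π := map_one (FreeMonoid.map (fun x : X => π • x))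

end NominalSets

section Monoids

variable (𝔸 : Type u)

/-- A pseudovariety of nominal monoids: a nonempty class of orbit-finite nominal monoids closed
under binary products, submonoids (injective morphisms into a member) and quotient monoids
(surjective morphisms from a member). -/
@[ext]
structure Pseudovariety : Type (u + 1) where
  members : Set (NomMonoid 𝔸)
  orbitFinite : ∀ M ∈ members, IsOrbitFinite 𝔸 M
  nonempty : members.Nonempty
  prod_mem : ∀ M ∈ members, ∀ N ∈ members, M.prod N ∈ members
  submonoid_mem : ∀ M ∈ members, ∀ (N : NomMonoid 𝔸) (i : N →* M),
    Equivariant 𝔸 i → Function.Injective i → N ∈ members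
  quotient_mem : ∀ M ∈ members, ∀ (N : NomMonoid 𝔸) (q : M →* N),
    Equivariant 𝔸 q → Function.Surjective q → N ∈ members

/-- Pseudovarieties are ordered by inclusion. -/
instance : PartialOrder (Pseudovariety 𝔸) :=
  PartialOrder.lift Pseudovariety.members fun _ _ h => Pseudovariety.ext h

end Monoids

section Languages

variable {𝔸 : Type u} {X : Type u} [MulAction (FinPerm 𝔸) X]

variable (𝔸) in
/-- A data language over `X`: a finitely supported set of words over `X`. -/
def IsDataLanguage (L : Set (FreeMonoid X)) : Prop := FinitelySupported 𝔸 L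

/-- The nominal monoid `M` recognizes the data language `L`: for some equivariant monoid morphism
`e : X* → M`, the language `L` is the preimage under `e` of a finitely supported subset of `M`. -/
def NomMonoid.Recognizes (M : NomMonoid 𝔸) (L : Set (FreeMonoid X)) : Prop :=
  IsDataLanguage 𝔸 L ∧ ∃ e : FreeMonoid X →* M, Equivariant 𝔸 e ∧
    ∃ P : Set M, FinitelySupported 𝔸 P ∧ L = e ⁻¹' P

variable (𝔸) in
/-- A language is recognizable if some orbit-finite nominal monoid recognizes it. -/
def IsRecognizable (L : Set (FreeMonoid X)) : Prop :=
  ∃ M : NomMonoid 𝔸, IsOrbitFinite 𝔸 M ∧ M.Recognizes L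

variable (𝔸) in
/-- Local varieties of data languages over `X`. -/
structure IsLocalVariety (V : Set (Set (FreeMonoid X))) : Prop where
  recognizable : ∀ L ∈ V, IsRecognizable 𝔸 L
  smul_mem : ∀ (π : FinPerm 𝔸), ∀ L ∈ V, π • L ∈ V
  empty_mem : ∅ ∈ V
  univ_mem : Set.univ ∈ V
  union_mem : ∀ K ∈ V, ∀ L ∈ V, K ∪ L ∈ V
  inter_mem : ∀ K ∈ V, ∀ L ∈ V, K ∩ L ∈ V
  compl_mem : ∀ L ∈ V, Lᶜ ∈ V
  /-- closure under unions of `S`-orbits -/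
  orbitUnion_mem : ∀ (S : Finset 𝔸), ∀ L ∈ V,
    (⋃ π ∈ {π : FinPerm 𝔸 | ∀ a ∈ S, π • a = a}, π • L) ∈ V
  leftDerivative_mem : ∀ (w : FreeMonoid X), ∀ L ∈ V, {v | w * v ∈ L} ∈ V
  rightDerivative_mem : ∀ (w : FreeMonoid X), ∀ L ∈ V, {v | v * w ∈ L} ∈ V

/-- The atomic languages of `V`: the minimal nonempty members of `V`. -/
def atomicLanguages (V : Set (Set (FreeMonoid X))) : Set (Set (FreeMonoid X)) :=
  {L | Minimal (fun K => K ∈ V ∧ K.Nonempty) L}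

variable (𝔸) in
/-- Atom-finite local varieties: the atomic languages form an orbit-finite set and every nonempty
member contains an atomic language. -/
structure IsAtomFiniteLocalVariety (V : Set (Set (FreeMonoid X))) : Prop where
  isLocalVariety : IsLocalVariety 𝔸 V
  orbitFinite : OrbitFiniteSet 𝔸 (atomicLanguages V)
  exists_atomic : ∀ L ∈ V, L.Nonempty → ∃ K ∈ atomicLanguages V, K ⊆ L

variable (𝔸) in
/-- Varieties of data languages: families of local varieties, indexed by all orbit-finite strong
nominal sets, that are closed under preimages and complete. -/
@[ext]
structure Variety : Type (u + 1) where
  lang : (A : Alphabet 𝔸) → Set (Set (FreeMonoid A))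
  isLocalVariety : ∀ A : Alphabet 𝔸, IsLocalVariety 𝔸 (lang A)
  preimage_mem : ∀ (B A : Alphabet 𝔸) (h : FreeMonoid B →* FreeMonoid A), Equivariant 𝔸 h →
    ∀ L ∈ lang A, h ⁻¹' L ∈ lang B
  complete : ∀ (A : Alphabet 𝔸) (V' : Set (Set (FreeMonoid A))),
    IsAtomFiniteLocalVariety 𝔸 V' → V' ⊆ lang A →
    ∃ (B : Alphabet 𝔸) (h : FreeMonoid A →* FreeMonoid B) (W' : Set (Set (FreeMonoid B))),
      Equivariant 𝔸 h ∧ IsAtomFiniteLocalVariety 𝔸 W' ∧ W' ⊆ lang B ∧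
      Set.BijOn (fun L => h ⁻¹' L) W' V' ∧
      ∀ L ∈ atomicLanguages W', ∃ w ∈ L, supp 𝔸 L = supp 𝔸 w

/-- Varieties are ordered by inclusion over every alphabet. -/
instance : PartialOrder (Variety 𝔸) :=
  PartialOrder.lift Variety.lang fun _ _ h => Variety.ext h

end Languages

/-- A partially ordered set is a complete lattice if all subsets have suprema and infima. -/
def IsCompleteLattice (P : Type*) [PartialOrder P] : Prop :=
  ∀ S : Set P, (∃ a, IsLUB S a) ∧ (∃ b, IsGLB S b)

end NomEil

namespace NomEil

/-! ### Least supports and equivariant maps -/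

section Supports

variable {𝔸 : Type u}

theorem finPerm_smul_def (π : FinPerm 𝔸) (a : 𝔸) : π • a = (π : Equiv.Perm 𝔸) a := rfl

/-- A map that is injective on a finite set of atoms extends to a finite permutation. -/
theorem exists_finPerm_extend (U : Finset 𝔸) (f : 𝔸 → 𝔸) (hf : Set.InjOn f U) :
    ∃ π : FinPerm 𝔸, ∀ a ∈ U, π • a = f a := by
  classical
  -- By cardinality, the injection of `U` into the finite set `F` extends to a permutation of `F`;
  -- outside `F` it is continued by the identity.
  let F := U ∪ U.image f
  obtain ⟨g, hg⟩ := Finset.exists_equiv_extend_of_card_eq (α := F) (t := F) (by simp)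
    (s := U.subtype (· ∈ F)) (f := fun a => f a)
    (by
      intro b hb
      obtain ⟨a, ha, rfl⟩ := Finset.mem_image.1 hb
      exact Finset.mem_union_right _ (Finset.mem_image_of_mem f (Finset.mem_subtype.1 ha)))
    (by
      intro a ha b hb h
      exact Subtype.ext (hf (Finset.mem_subtype.1 ha) (Finset.mem_subtype.1 hb) h))
  refine ⟨⟨Equiv.Perm.ofSubtype (g : Equiv.Perm F), ?_⟩, fun a ha => ?_⟩
  · refine F.finite_toSet.subset fun a ha => ?_
    by_contra h
    exact ha (Equiv.Perm.ofSubtype_apply_of_not_mem _ h)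
  · have haF : a ∈ F := Finset.mem_union_left _ ha
    rw [finPerm_smul_def]
    exact (Equiv.Perm.ofSubtype_apply_of_mem _ haF).trans
      (hg ⟨a, haF⟩ (Finset.mem_subtype.2 ha))

theorem swap_mem_finPerm [DecidableEq 𝔸] (a b : 𝔸) : Equiv.swap a b ∈ finPerm 𝔸 := by
  refine (Set.toFinite {a, b}).subset fun c hc => ?_
  by_contra h
  simp only [Set.mem_insert_iff, Set.mem_singleton_iff, not_or] at h
  exact hc (Equiv.swap_apply_of_ne_of_ne h.1 h.2)

section

variable {X Y : Type u} [MulAction (FinPerm 𝔸) X] [MulAction (FinPerm 𝔸) Y]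

/-- The intersection of two finite supports is a support. -/
theorem supports_inter [Infinite 𝔸] [DecidableEq 𝔸] {S T : Finset 𝔸} {x : X}
    (hS : MulAction.Supports (FinPerm 𝔸) (S : Set 𝔸) x)
    (hT : MulAction.Supports (FinPerm 𝔸) (T : Set 𝔸) x) :
    MulAction.Supports (FinPerm 𝔸) ((S ∩ T : Finset 𝔸) : Set 𝔸) x := by
  -- The atom `a` misses `S` or `T`, and `c` misses both, so the transposition fixes one of the two
  -- supports pointwise.
  have key : ∀ a c : 𝔸, a ∉ S ∩ T → c ∉ S → c ∉ T →
      (⟨Equiv.swap a c, swap_mem_finPerm a c⟩ : FinPerm 𝔸) • x = x := by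
    intro a c ha hcS hcT
    by_cases haS : a ∈ S
    · have haT : a ∉ T := fun h => ha (Finset.mem_inter.2 ⟨haS, h⟩)
      exact hT _ fun b hb => Equiv.swap_apply_of_ne_of_ne
        (fun h => haT (h ▸ hb)) (fun h => hcT (h ▸ hb))
    · exact hS _ fun b hb => Equiv.swap_apply_of_ne_of_ne
        (fun h => haS (h ▸ hb)) (fun h => hcS (h ▸ hb))
  let G : Set (Equiv.Perm 𝔸) := {σ | ∃ a b, a ≠ b ∧ a ∉ S ∩ T ∧ b ∉ S ∩ T ∧ σ = Equiv.swap a b}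
  have hG : ∀ σ ∈ G, σ.IsSwap := by
    rintro σ ⟨a, b, hab, -, -, rfl⟩
    exact ⟨a, b, hab, rfl⟩
  have hle : Subgroup.closure G ≤
      (MulAction.stabilizer (FinPerm 𝔸) x).map (finPerm 𝔸).subtype := by
    rw [Subgroup.closure_le]
    rintro σ ⟨a, b, hab, ha, hb, rfl⟩
    refine ⟨⟨Equiv.swap a b, swap_mem_finPerm a b⟩, ?_, rfl⟩
    obtain ⟨c, hc⟩ := Infinite.exists_notMem_finset (S ∪ T ∪ {a, b})
    simp only [Finset.mem_union, Finset.mem_insert, Finset.mem_singleton, not_or] at hc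
    obtain ⟨⟨hcS, hcT⟩, hca, hcb⟩ := hc
    -- Conjugating through the fresh atom `c` reduces to `key`, which does not apply directly when,
    -- say, `a` lies in `S` and `b` in `T`.
    have e : (⟨Equiv.swap a b, swap_mem_finPerm a b⟩ : FinPerm 𝔸) =
        ⟨Equiv.swap a c, swap_mem_finPerm a c⟩ * ⟨Equiv.swap b c, swap_mem_finPerm b c⟩ *
          ⟨Equiv.swap a c, swap_mem_finPerm a c⟩ := by
      refine Subtype.ext ?_
      change Equiv.swap a b = Equiv.swap a c * Equiv.swap b c * Equiv.swap a c
      ext x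
      simp only [Equiv.Perm.mul_apply, Equiv.swap_apply_def]
      grind
    change _ • x = x
    rw [e, mul_smul, mul_smul, key a c ha hcS hcT, key b c hb hcS hcT, key a c ha hcS hcT]
  intro π hπ
  have hmem : (π : Equiv.Perm 𝔸) ∈ Subgroup.closure G := by
    rw [mem_closure_isSwap hG]
    refine ⟨π.2, fun a => ?_⟩
    by_cases h : π • a = a
    · exact ⟨1, h.symm⟩
    · have ha : a ∉ S ∩ T := fun h' => h (hπ (Finset.mem_coe.2 h'))
      have hb : π • a ∉ S ∩ T := fun h' => h (smul_left_cancel π (hπ (Finset.mem_coe.2 h')))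
      exact ⟨⟨Equiv.swap a (π • a), Subgroup.subset_closure ⟨a, π • a, Ne.symm h, ha, hb, rfl⟩⟩,
        Equiv.swap_apply_left _ _⟩
  obtain ⟨ρ, hρ, e⟩ := hle hmem
  have : ρ = π := Subtype.ext e
  exact this ▸ hρ

/-- The least support of a finitely supported element is a finite support. -/
theorem exists_supp_eq [Infinite 𝔸] {x : X} (hx : FinitelySupported 𝔸 x) :
    ∃ S : Finset 𝔸, supp 𝔸 x = S ∧ MulAction.Supports (FinPerm 𝔸) (S : Set 𝔸) x := by
  classical
  have hne : {S : Finset 𝔸 | MulAction.Supports (FinPerm 𝔸) (S : Set 𝔸) x}.Nonempty := hx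
  -- A support of least cardinality lies in every other finite support, since intersecting cannot
  -- make it smaller.
  obtain ⟨S, hS, hmin⟩ := (measure Finset.card).wf.has_min _ hne
  refine ⟨S, Set.Subset.antisymm (fun a ha => ha S hS) fun a ha T hT => ?_, hS⟩
  have h := hmin _ (supports_inter hS hT)
  have h1 : S ∩ T = S := Finset.eq_of_subset_of_card_le Finset.inter_subset_left (not_lt.1 h)
  exact (Finset.mem_inter.1 (h1.symm ▸ ha : a ∈ S ∩ T)).2

theorem smul_eq_of_fixes_supp [Infinite 𝔸] {x : X} (hx : FinitelySupported 𝔸 x) {π : FinPerm 𝔸}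
    (h : ∀ a ∈ supp 𝔸 x, π • a = a) : π • x = x := by
  obtain ⟨S, e, hS⟩ := exists_supp_eq hx
  exact hS π fun a ha => h a (e ▸ ha)

/-- If the permutations fixing `x` are those fixing the finite set `F`, then `F` is the least
support of `x`. -/
theorem supp_eq_of_stabilizer [Infinite 𝔸] {x : X} {F : Finset 𝔸}
    (h : ∀ π : FinPerm 𝔸, π • x = x ↔ ∀ a ∈ F, π • a = a) : supp 𝔸 x = F := by
  classical
  refine Set.Subset.antisymm (fun a ha => ha F fun π hπ => (h π).2 fun a ha => hπ ha) ?_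
  intro a ha S hS
  by_contra haS
  obtain ⟨c, hc⟩ := Infinite.exists_notMem_finset (insert a S)
  simp only [Finset.mem_insert, not_or] at hc
  -- Swapping `a` with a fresh atom fixes `S` pointwise and hence `x`, although it moves `a ∈ F`.
  have := (h ⟨Equiv.swap a c, swap_mem_finPerm a c⟩).1 (hS _ fun b hb =>
    Equiv.swap_apply_of_ne_of_ne (fun h => haS (h ▸ hb)) (fun h => hc.2 (h ▸ hb))) a ha
  exact hc.1 ((Equiv.swap_apply_left a c).symm.trans this)

theorem supports_smul [DecidableEq 𝔸] {x : X} {S : Finset 𝔸}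
    (hS : MulAction.Supports (FinPerm 𝔸) (S : Set 𝔸) x) (π : FinPerm 𝔸) :
    MulAction.Supports (FinPerm 𝔸) ((S.image (π • ·) : Finset 𝔸) : Set 𝔸) (π • x) := by
  intro ρ hρ
  have : (π⁻¹ * ρ * π) • x = x := hS _ fun a ha => by
    rw [mul_smul, mul_smul, hρ (Finset.mem_coe.2 (Finset.mem_image_of_mem _ ha)), inv_smul_smul]
  rw [mul_smul, mul_smul, inv_smul_eq_iff] at this
  exact this

theorem FinitelySupported.smul {x : X} (hx : FinitelySupported 𝔸 x) (π : FinPerm 𝔸) :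
    FinitelySupported 𝔸 (π • x) := by
  classical
  obtain ⟨S, hS⟩ := hx
  exact ⟨_, supports_smul hS π⟩

theorem Equivariant.supports {f : X → Y} (hf : Equivariant 𝔸 f) {S : Set 𝔸} {x : X}
    (h : MulAction.Supports (FinPerm 𝔸) S x) : MulAction.Supports (FinPerm 𝔸) S (f x) :=
  fun π hπ => by rw [← hf, h π hπ]

theorem Equivariant.finitelySupported {f : X → Y} (hf : Equivariant 𝔸 f) {x : X}
    (h : FinitelySupported 𝔸 x) : FinitelySupported 𝔸 (f x) :=
  h.imp fun _ hS => hf.supports hS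

theorem Equivariant.supports_iff {f : X → Y} (hf : Equivariant 𝔸 f) (hi : Function.Injective f)
    {S : Set 𝔸} {x : X} :
    MulAction.Supports (FinPerm 𝔸) S (f x) ↔ MulAction.Supports (FinPerm 𝔸) S x :=
  ⟨fun h π hπ => hi (by rw [hf, h π hπ]), hf.supports⟩

theorem Equivariant.supp_subset {f : X → Y} (hf : Equivariant 𝔸 f) (x : X) :
    supp 𝔸 (f x) ⊆ supp 𝔸 x :=
  fun _ ha S hS => ha S (hf.supports hS)

theorem Equivariant.supp_eq {f : X → Y} (hf : Equivariant 𝔸 f) (hi : Function.Injective f)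
    (x : X) : supp 𝔸 (f x) = supp 𝔸 x := by
  simp only [supp, hf.supports_iff hi]

theorem Equivariant.comp {Z : Type u} [MulAction (FinPerm 𝔸) Z] {g : Y → Z} {f : X → Y}
    (hg : Equivariant 𝔸 g) (hf : Equivariant 𝔸 f) : Equivariant 𝔸 (g ∘ f) := fun π x => by
  simp only [Function.comp_apply, hf π x, hg π (f x)]

theorem Equivariant.preimage_smul {f : X → Y} (hf : Equivariant 𝔸 f) (π : FinPerm 𝔸) (P : Set Y) :
    f ⁻¹' (π • P) = π • f ⁻¹' P := by
  ext x
  simp only [Set.mem_preimage, Set.mem_smul_set_iff_inv_smul_mem, hf π⁻¹ x]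

theorem Equivariant.image_smul {f : X → Y} (hf : Equivariant 𝔸 f) (π : FinPerm 𝔸) (P : Set X) :
    f '' (π • P) = π • f '' P := by
  ext y
  simp only [Set.mem_image, Set.mem_smul_set]
  constructor
  · rintro ⟨_, ⟨x, hx, rfl⟩, rfl⟩
    exact ⟨f x, ⟨x, hx, rfl⟩, (hf π x).symm⟩
  · rintro ⟨_, ⟨x, hx, rfl⟩, rfl⟩
    exact ⟨π • x, ⟨x, hx, rfl⟩, hf π x⟩

theorem Equivariant.fiber {f : X → Y} (hf : Equivariant 𝔸 f) :
    Equivariant 𝔸 (fun y : Y => f ⁻¹' {y}) := fun π y => by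
  simp only [← Set.smul_set_singleton, hf.preimage_smul]

theorem equivariant_singleton : Equivariant 𝔸 (fun x : X => ({x} : Set X)) := fun _ _ =>
  Set.smul_set_singleton.symm

theorem fiber_injective {f : X → Y} (hs : Function.Surjective f) :
    Function.Injective (fun y : Y => f ⁻¹' {y}) := fun y z h => by
  obtain ⟨x, rfl⟩ := hs y
  exact (h.subset (rfl : x ∈ f ⁻¹' {f x}) : f x ∈ ({z} : Set Y))

theorem Equivariant.preimage {f : X → Y} (hf : Equivariant 𝔸 f) :
    Equivariant 𝔸 (fun P : Set Y => f ⁻¹' P) := hf.preimage_smul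

theorem Equivariant.image {f : X → Y} (hf : Equivariant 𝔸 f) :
    Equivariant 𝔸 (fun P : Set X => f '' P) := hf.image_smul

end

end Supports

/-! ### Orbit-finite sets -/

section OrbitFinite

variable {𝔸 : Type u} {X Y : Type u} [MulAction (FinPerm 𝔸) X] [MulAction (FinPerm 𝔸) Y]

theorem orbitFiniteSet_iff {T : Set X} : OrbitFiniteSet 𝔸 T ↔
    ∃ R : Set X, R.Finite ∧ ∀ x ∈ T, ∃ r ∈ R, ∃ π : FinPerm 𝔸, π • r = x := by
  constructor
  · intro h
    obtain ⟨R, -, hbij⟩ := Set.exists_subset_bijOn T (MulAction.orbit (FinPerm 𝔸))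
    have e := hbij.image_eq
    have hfin : R.Finite := Set.Finite.of_finite_image (by rw [e]; exact h) hbij.injOn
    refine ⟨R, hfin, fun x hx => ?_⟩
    obtain ⟨r, hr, h⟩ : MulAction.orbit (FinPerm 𝔸) x ∈ MulAction.orbit (FinPerm 𝔸) '' R :=
      e ▸ ⟨x, hx, rfl⟩
    have : x ∈ MulAction.orbit (FinPerm 𝔸) r := h ▸ MulAction.mem_orbit_self x
    exact ⟨r, hr, this⟩
  · rintro ⟨R, hR, h⟩
    refine (hR.image (MulAction.orbit (FinPerm 𝔸))).subset ?_
    rintro _ ⟨x, hx, rfl⟩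
    obtain ⟨r, hr, hπ⟩ := h x hx
    exact ⟨r, hr, (MulAction.orbit_eq_iff.2 hπ).symm⟩

theorem OrbitFiniteSet.mono {S T : Set X} (hT : OrbitFiniteSet 𝔸 T) (h : S ⊆ T) :
    OrbitFiniteSet 𝔸 S :=
  Set.Finite.subset hT (Set.image_mono h)

theorem OrbitFiniteSet.image {T : Set X} (hT : OrbitFiniteSet 𝔸 T) {f : X → Y}
    (hf : Equivariant 𝔸 f) : OrbitFiniteSet 𝔸 (f '' T) := by
  obtain ⟨R, hR, h⟩ := orbitFiniteSet_iff.1 hT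
  refine orbitFiniteSet_iff.2 ⟨f '' R, hR.image f, ?_⟩
  rintro _ ⟨x, hx, rfl⟩
  obtain ⟨r, hr, π, rfl⟩ := h x hx
  exact ⟨f r, ⟨r, hr, rfl⟩, π, (hf π r).symm⟩

theorem OrbitFiniteSet.union {S T : Set X} (hS : OrbitFiniteSet 𝔸 S) (hT : OrbitFiniteSet 𝔸 T) :
    OrbitFiniteSet 𝔸 (S ∪ T) := by
  rw [OrbitFiniteSet, Set.image_union]
  exact Set.Finite.union hS hT

theorem IsOrbitFinite.of_surjective (hX : IsOrbitFinite 𝔸 X) {f : X → Y} (hf : Equivariant 𝔸 f)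
    (hs : Function.Surjective f) : IsOrbitFinite 𝔸 Y := by
  have := OrbitFiniteSet.image hX hf
  rwa [Set.image_univ, hs.range_eq] at this

theorem IsOrbitFinite.orbitFiniteSet (hX : IsOrbitFinite 𝔸 X) (T : Set X) : OrbitFiniteSet 𝔸 T :=
  OrbitFiniteSet.mono hX (Set.subset_univ T)

theorem OrbitFiniteSet.of_injective {T : Set X} {f : X → Y} (hf : Equivariant 𝔸 f)
    (hi : Function.Injective f) (h : OrbitFiniteSet 𝔸 (f '' T)) : OrbitFiniteSet 𝔸 T := by
  obtain ⟨R, hR, h⟩ := orbitFiniteSet_iff.1 h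
  refine orbitFiniteSet_iff.2 ⟨f ⁻¹' R, hR.preimage hi.injOn, fun x hx => ?_⟩
  obtain ⟨r, hr, π, e⟩ := h _ ⟨x, hx, rfl⟩
  have e' : r = f (π⁻¹ • x) := by rw [hf, ← e, inv_smul_smul]
  exact ⟨π⁻¹ • x, by rw [Set.mem_preimage, ← e']; exact hr, π, smul_inv_smul π x⟩

/-- The orbit of a finitely supported element splits into finitely many orbits of the group of
permutations that fix a given finite set of atoms. -/
theorem exists_finite_reps_orbit {r : X} (hr : FinitelySupported 𝔸 r) (S : Finset 𝔸) (T : Set X) :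
    ∃ R ⊆ T, R.Finite ∧ ∀ x ∈ T, x ∈ MulAction.orbit (FinPerm 𝔸) r →
      ∃ y ∈ R, ∃ ρ : FinPerm 𝔸, (∀ a ∈ S, ρ • a = a) ∧ ρ • y = x := by
  classical
  obtain ⟨U, hU⟩ := hr
  let Z : Set X := T ∩ MulAction.orbit (FinPerm 𝔸) r
  have hZ : ∀ x : Z, ∃ π : FinPerm 𝔸, π • r = x := fun x => x.2.2
  choose p hp using hZ
  -- The color of `x = p x • r` records which atoms of the support `U` are sent into `S`, and where.
  -- There are finitely many colors, and points of equal color turn out to be related by a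
  -- permutation fixing `S`.
  let c : Z → (U → Option S) := fun x t =>
    if h : p x • (t : 𝔸) ∈ S then some ⟨p x • (t : 𝔸), h⟩ else none
  have hc : ∀ x y : Z, c x = c y → ∀ t ∈ U, (p x • t ∈ S ∨ p y • t ∈ S) → p x • t = p y • t := by
    intro x y h t ht hS
    have h' := congrFun h ⟨t, ht⟩
    simp only [c] at h'
    by_cases h1 : p x • t ∈ S <;> by_cases h2 : p y • t ∈ S <;> simp_all
  have key : ∀ x y : Z, c x = c y →
      ∃ ρ : FinPerm 𝔸, (∀ a ∈ S, ρ • a = a) ∧ ρ • (x : X) = y := by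
    intro x y h
    -- The prescription is the identity on `S` and `p x • t ↦ p y • t` elsewhere; equality of colors
    -- makes the two compatible and jointly injective.
    obtain ⟨ρ, hρ⟩ := exists_finPerm_extend (S ∪ U.image (p x • ·))
      (fun a => if a ∈ S then a else p y • (p x)⁻¹ • a) (by
        have h1 : ∀ a ∈ S ∪ U.image (p x • ·), a ∉ S → p y • (p x)⁻¹ • a ∉ S := by
          intro a ha haS h'
          rcases Finset.mem_union.1 ha with ha | ha
          · exact haS ha
          · obtain ⟨t, ht, rfl⟩ := Finset.mem_image.1 ha
            simp only [inv_smul_smul] at h'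
            have := hc x y h t ht (Or.inr h')
            exact haS (by simpa only [this] using h')
        intro a ha b hb hab
        simp only at hab
        split_ifs at hab with h2 h3 h3
        · exact hab
        · exact absurd (hab ▸ h2) (h1 b hb h3)
        · exact absurd (hab.symm ▸ h3) (h1 a ha h2)
        · exact smul_left_cancel _ (smul_left_cancel _ hab))
    refine ⟨ρ, fun a ha => ?_, ?_⟩
    · rw [hρ a (Finset.mem_union_left _ ha), if_pos ha]
    · have : ((p y)⁻¹ * ρ * p x) • r = r := hU _ fun t ht => by
        have ht : t ∈ U := ht
        rw [mul_smul, mul_smul, hρ _ (Finset.mem_union_right _ (Finset.mem_image_of_mem _ ht))]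
        split_ifs with h2
        · rw [hc x y h t ht (Or.inl h2), inv_smul_smul]
        · rw [inv_smul_smul, inv_smul_smul]
      rw [mul_smul, mul_smul, inv_smul_eq_iff, hp, hp] at this
      exact this
  let s : Set.range c → Z := fun k => k.2.choose
  have hs : ∀ k, c (s k) = k := fun k => k.2.choose_spec
  refine ⟨Set.range fun k => (s k : X), ?_, Set.finite_range _, fun x hx hxr => ?_⟩
  · rintro _ ⟨k, rfl⟩
    exact (s k).2.1
  · exact ⟨_, ⟨⟨c ⟨x, hx, hxr⟩, ⟨_, rfl⟩⟩, rfl⟩, key _ ⟨x, hx, hxr⟩ (hs _)⟩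

/-- An orbit-finite set of finitely supported elements consists of finitely many orbits under the
permutations that fix a given finite set of atoms. -/
theorem OrbitFiniteSet.exists_finite_reps {T : Set X} (hT : OrbitFiniteSet 𝔸 T)
    (hfs : ∀ x ∈ T, FinitelySupported 𝔸 x) (S : Finset 𝔸) :
    ∃ R ⊆ T, R.Finite ∧ ∀ x ∈ T, ∃ y ∈ R, ∃ ρ : FinPerm 𝔸, (∀ a ∈ S, ρ • a = a) ∧ ρ • y = x := by
  obtain ⟨R, hR, h⟩ := orbitFiniteSet_iff.1 hT
  have : ∀ r : X, ∃ R' ⊆ T, R'.Finite ∧ ∀ x ∈ T, x ∈ MulAction.orbit (FinPerm 𝔸) r →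
      ∃ y ∈ R', ∃ ρ : FinPerm 𝔸, (∀ a ∈ S, ρ • a = a) ∧ ρ • y = x := by
    intro r
    by_cases hr : FinitelySupported 𝔸 r
    · exact exists_finite_reps_orbit hr S T
    -- Representatives of orbits need not lie in `T`; the orbit of one without finite support does
    -- not meet `T`.
    · refine ⟨∅, Set.empty_subset _, Set.finite_empty, fun x hx hxr => absurd ?_ hr⟩
      obtain ⟨π, rfl⟩ := hxr
      simpa using (hfs _ hx).smul π⁻¹
  choose Q hQT hQ hQrep using this
  refine ⟨⋃ r ∈ R, Q r, Set.iUnion₂_subset fun r _ => hQT r, hR.biUnion fun r _ => hQ r,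
    fun x hx => ?_⟩
  obtain ⟨r, hr, hx'⟩ := h x hx
  obtain ⟨y, hy, hρ⟩ := hQrep r x hx hx'
  exact ⟨y, Set.mem_biUnion hr hy, hρ⟩

/-- Products of orbit-finite nominal sets are orbit-finite. -/
theorem IsOrbitFinite.prod (hX : IsOrbitFinite 𝔸 X) (hY : IsOrbitFinite 𝔸 Y)
    (nX : IsNominal 𝔸 X) (nY : IsNominal 𝔸 Y) : IsOrbitFinite 𝔸 (X × Y) := by
  obtain ⟨R, hR, h⟩ := orbitFiniteSet_iff.1 hX
  choose S hS using nX
  choose Q _ hQ hQrep using fun x => OrbitFiniteSet.exists_finite_reps hY (fun y _ => nY y) (S x)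
  refine orbitFiniteSet_iff.2 ⟨⋃ r ∈ R, (fun y => (r, y)) '' Q r,
    hR.biUnion fun r _ => (hQ r).image _, ?_⟩
  rintro ⟨x, y⟩ -
  obtain ⟨r, hr, π, rfl⟩ := h x trivial
  -- Once the first coordinate is moved to `r`, the second may be moved only by permutations fixing
  -- the support of `r`.
  obtain ⟨z, hz, ρ, hρ, e⟩ := hQrep r (π⁻¹ • y) trivial
  refine ⟨(r, z), Set.mem_biUnion hr ⟨z, hz, rfl⟩, π * ρ, ?_⟩
  rw [Prod.smul_mk, mul_smul, mul_smul, e, smul_inv_smul, hS r ρ fun a ha => hρ a ha]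

end OrbitFinite

end NomEil

namespace NomEil

/-! ### Finitely supported subsets -/

section FinitelySupportedSets

variable {𝔸 : Type u} {X Y : Type u} [MulAction (FinPerm 𝔸) X] [MulAction (FinPerm 𝔸) Y]

theorem FinitelySupported.common {x : X} {y : Y} (hx : FinitelySupported 𝔸 x)
    (hy : FinitelySupported 𝔸 y) : ∃ S : Finset 𝔸,
      MulAction.Supports (FinPerm 𝔸) (S : Set 𝔸) x ∧
      MulAction.Supports (FinPerm 𝔸) (S : Set 𝔸) y := by
  classical
  obtain ⟨S, hS⟩ := hx
  obtain ⟨T, hT⟩ := hy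
  exact ⟨S ∪ T, hS.mono (by simp), hT.mono (by simp)⟩

theorem finitelySupported_of_fixed {x : X} (h : ∀ π : FinPerm 𝔸, π • x = x) :
    FinitelySupported 𝔸 x :=
  ⟨∅, fun π _ => h π⟩

theorem FinitelySupported.union {P Q : Set X} (hP : FinitelySupported 𝔸 P)
    (hQ : FinitelySupported 𝔸 Q) : FinitelySupported 𝔸 (P ∪ Q) := by
  obtain ⟨S, h1, h2⟩ := hP.common hQ
  exact ⟨S, fun π hπ => by rw [Set.smul_set_union, h1 π hπ, h2 π hπ]⟩

theorem FinitelySupported.inter {P Q : Set X} (hP : FinitelySupported 𝔸 P)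
    (hQ : FinitelySupported 𝔸 Q) : FinitelySupported 𝔸 (P ∩ Q) := by
  obtain ⟨S, h1, h2⟩ := hP.common hQ
  exact ⟨S, fun π hπ => by rw [Set.smul_set_inter, h1 π hπ, h2 π hπ]⟩

theorem FinitelySupported.compl {P : Set X} (hP : FinitelySupported 𝔸 P) :
    FinitelySupported 𝔸 Pᶜ :=
  hP.imp fun _ hS π hπ => by rw [Set.smul_set_compl, hS π hπ]

theorem finitelySupported_singleton {x : X} (hx : FinitelySupported 𝔸 x) :
    FinitelySupported 𝔸 ({x} : Set X) :=
  equivariant_singleton.finitelySupported hx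

theorem smul_orbitUnion (S : Finset 𝔸) (P : Set X) {ρ : FinPerm 𝔸} (hρ : ∀ a ∈ S, ρ • a = a) :
    ρ • (⋃ π ∈ {π : FinPerm 𝔸 | ∀ a ∈ S, π • a = a}, π • P) =
      ⋃ π ∈ {π : FinPerm 𝔸 | ∀ a ∈ S, π • a = a}, π • P := by
  simp only [Set.smul_set_iUnion₂, smul_smul]
  refine Set.Subset.antisymm (Set.iUnion₂_subset fun π hπ => ?_)
    (Set.iUnion₂_subset fun π hπ => ?_)
  · refine Set.subset_iUnion₂_of_subset (ρ * π) (fun a ha => ?_) subset_rfl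
    rw [mul_smul, hπ a ha, hρ a ha]
  · refine Set.subset_iUnion₂_of_subset (ρ⁻¹ * π) (fun a ha => ?_) ?_
    · rw [mul_smul, hπ a ha, inv_smul_eq_iff, hρ a ha]
    · rw [mul_inv_cancel_left]

theorem Equivariant.preimage_orbitUnion {f : X → Y} (hf : Equivariant 𝔸 f) (S : Finset 𝔸)
    (P : Set Y) : f ⁻¹' (⋃ π ∈ {π : FinPerm 𝔸 | ∀ a ∈ S, π • a = a}, π • P) =
      ⋃ π ∈ {π : FinPerm 𝔸 | ∀ a ∈ S, π • a = a}, π • f ⁻¹' P := by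
  simp only [Set.preimage_iUnion₂, hf.preimage_smul]

end FinitelySupportedSets

/-! ### Local varieties and languages recognized by a morphism -/

section LocalVarieties

variable {𝔸 : Type u} {X : Type u} [MulAction (FinPerm 𝔸) X] {V : Set (Set (FreeMonoid X))}

theorem IsRecognizable.finitelySupported {L : Set (FreeMonoid X)} (h : IsRecognizable 𝔸 L) :
    FinitelySupported 𝔸 L := by
  obtain ⟨M, -, h, -⟩ := h
  exact h

theorem IsLocalVariety.finitelySupported (hV : IsLocalVariety 𝔸 V) {L : Set (FreeMonoid X)}
    (hL : L ∈ V) : FinitelySupported 𝔸 L :=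
  (hV.recognizable L hL).finitelySupported

theorem IsLocalVariety.biUnion_mem (hV : IsLocalVariety 𝔸 V) {ι : Type*} {R : Set ι}
    (hR : R.Finite) {f : ι → Set (FreeMonoid X)} (h : ∀ i ∈ R, f i ∈ V) : (⋃ i ∈ R, f i) ∈ V := by
  induction R, hR using Set.Finite.induction_on with
  | empty => simpa using hV.empty_mem
  | insert _ _ ih =>
    rw [Set.biUnion_insert]
    exact hV.union_mem _ (h _ (Set.mem_insert _ _)) _
      (ih fun i hi => h i (Set.mem_insert_of_mem _ hi))

/-- A local variety contains the union of every finitely supported orbit-finite family of its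
members. -/
theorem IsLocalVariety.sUnion_mem (hV : IsLocalVariety 𝔸 V) {T : Set (Set (FreeMonoid X))}
    (hTV : T ⊆ V) (hT : OrbitFiniteSet 𝔸 T) (S : Finset 𝔸)
    (hS : ∀ ρ : FinPerm 𝔸, (∀ a ∈ S, ρ • a = a) → ∀ L ∈ T, ρ • L ∈ T) : ⋃₀ T ∈ V := by
  obtain ⟨R, hRT, hR, h⟩ := hT.exists_finite_reps (fun L hL => hV.finitelySupported (hTV hL)) S
  -- The family splits into finitely many `S`-orbits, and the union of each one is provided by
  -- closure under orbit unions.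
  have e : ⋃₀ T = ⋃ L ∈ R, ⋃ π ∈ {π : FinPerm 𝔸 | ∀ a ∈ S, π • a = a}, π • L := by
    refine Set.Subset.antisymm (Set.sUnion_subset fun L hL => ?_)
      (Set.iUnion₂_subset fun L hL => Set.iUnion₂_subset fun π hπ =>
        Set.subset_sUnion_of_mem (hS π hπ L (hRT hL)))
    obtain ⟨K, hK, ρ, hρ, rfl⟩ := h L hL
    exact Set.subset_iUnion₂_of_subset K hK (Set.subset_iUnion₂_of_subset ρ hρ subset_rfl)
  rw [e]
  exact hV.biUnion_mem hR fun L hL => hV.orbitUnion_mem S L (hTV (hRT hL))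

/-- A local variety that contains all fibers of an equivariant map into an orbit-finite set
contains the preimages of all finitely supported subsets. -/
theorem IsLocalVariety.preimage_mem (hV : IsLocalVariety 𝔸 V) {M : Type u}
    [MulAction (FinPerm 𝔸) M] (hM : IsOrbitFinite 𝔸 M) {e : FreeMonoid X → M}
    (he : Equivariant 𝔸 e) (h : ∀ m, e ⁻¹' {m} ∈ V) {P : Set M} (hP : FinitelySupported 𝔸 P) :
    e ⁻¹' P ∈ V := by
  obtain ⟨S, hS⟩ := hP
  have eq : e ⁻¹' P = ⋃₀ ((fun m => e ⁻¹' {m}) '' P) := by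
    ext u
    simp
  rw [eq]
  refine hV.sUnion_mem ?_ ((hM.orbitFiniteSet P).image he.fiber) S ?_
  · rintro _ ⟨m, -, rfl⟩
    exact h m
  · rintro ρ hρ _ ⟨m, hm, rfl⟩
    refine ⟨ρ • m, ?_, he.fiber ρ m⟩
    rw [← hS ρ hρ]
    exact Set.smul_mem_smul_set hm

theorem mem_atomicLanguages {L : Set (FreeMonoid X)} : L ∈ atomicLanguages V ↔
    L ∈ V ∧ L.Nonempty ∧ ∀ K ∈ V, K.Nonempty → K ⊆ L → L ⊆ K :=
  ⟨fun h => ⟨h.1.1, h.1.2, fun _ hK hne => h.2 ⟨hK, hne⟩⟩,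
    fun h => ⟨⟨h.1, h.2.1⟩, fun _ hK => h.2.2 _ hK.1 hK.2⟩⟩

variable (𝔸) in
/-- The data languages recognized by a fixed morphism. -/
def recognizedBy {M : Type u} [MulAction (FinPerm 𝔸) M] (e : FreeMonoid X → M) :
    Set (Set (FreeMonoid X)) :=
  {L | ∃ P : Set M, FinitelySupported 𝔸 P ∧ L = e ⁻¹' P}

theorem recognizes_of_mem {M : NomMonoid 𝔸} {e : FreeMonoid X →* M} (he : Equivariant 𝔸 e)
    {L : Set (FreeMonoid X)} (h : L ∈ recognizedBy 𝔸 e) : M.Recognizes L := by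
  obtain ⟨P, hP, rfl⟩ := h
  exact ⟨he.preimage.finitelySupported hP, e, he, P, hP, rfl⟩

theorem recognizes_iff {M : NomMonoid 𝔸} {L : Set (FreeMonoid X)} :
    M.Recognizes L ↔ ∃ e : FreeMonoid X →* M, Equivariant 𝔸 e ∧ L ∈ recognizedBy 𝔸 e :=
  ⟨fun h => h.2, fun ⟨_, he, h⟩ => recognizes_of_mem he h⟩

omit [MulAction (FinPerm 𝔸) X] in
theorem fiber_mem_recognizedBy {M : NomMonoid 𝔸} (e : FreeMonoid X → M) (m : M) :
    e ⁻¹' {m} ∈ recognizedBy 𝔸 e :=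
  ⟨{m}, finitelySupported_singleton (M.nominal m), rfl⟩

/-- Each closure operation on languages is the preimage under `e` of an operation on finitely
supported subsets of `M`; a derivative by `w` becomes a translation by `e w`. -/
theorem isLocalVariety_recognizedBy {M : NomMonoid 𝔸} (hM : IsOrbitFinite 𝔸 M)
    {e : FreeMonoid X →* M} (he : Equivariant 𝔸 e) : IsLocalVariety 𝔸 (recognizedBy 𝔸 e) where
  recognizable L hL := ⟨M, hM, recognizes_of_mem he hL⟩
  smul_mem := by
    rintro π _ ⟨P, hP, rfl⟩
    exact ⟨π • P, hP.smul π, (he.preimage_smul π P).symm⟩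
  empty_mem := ⟨∅, finitelySupported_of_fixed fun _ => Set.smul_set_empty, rfl⟩
  univ_mem := ⟨Set.univ, finitelySupported_of_fixed fun _ => Set.smul_set_univ, rfl⟩
  union_mem := by
    rintro _ ⟨P, hP, rfl⟩ _ ⟨Q, hQ, rfl⟩
    exact ⟨P ∪ Q, hP.union hQ, rfl⟩
  inter_mem := by
    rintro _ ⟨P, hP, rfl⟩ _ ⟨Q, hQ, rfl⟩
    exact ⟨P ∩ Q, hP.inter hQ, rfl⟩
  compl_mem := by
    rintro _ ⟨P, hP, rfl⟩
    exact ⟨Pᶜ, hP.compl, rfl⟩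
  orbitUnion_mem := by
    rintro S _ ⟨P, hP, rfl⟩
    exact ⟨_, ⟨S, fun ρ hρ => smul_orbitUnion S P fun a ha => hρ ha⟩,
      (he.preimage_orbitUnion S P).symm⟩
  leftDerivative_mem := by
    rintro w _ ⟨P, hP, rfl⟩
    obtain ⟨S, hS, hw⟩ := hP.common (M.nominal (e w))
    refine ⟨{m | e w * m ∈ P}, ⟨S, fun π hπ => ?_⟩, by ext v; simp⟩
    ext m
    rw [Set.mem_smul_set_iff_inv_smul_mem, Set.mem_ofPred_eq, Set.mem_ofPred_eq]
    -- As `π` fixes `e w`, this factor may be written `π⁻¹ • e w`, which lets `π⁻¹` be pulled out of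
    -- the product.
    nth_rw 1 [← inv_smul_eq_iff.2 (hw π hπ).symm]
    rw [← smul_mul', ← Set.mem_smul_set_iff_inv_smul_mem, hS π hπ]
  rightDerivative_mem := by
    rintro w _ ⟨P, hP, rfl⟩
    obtain ⟨S, hS, hw⟩ := hP.common (M.nominal (e w))
    refine ⟨{m | m * e w ∈ P}, ⟨S, fun π hπ => ?_⟩, by ext v; simp⟩
    ext m
    rw [Set.mem_smul_set_iff_inv_smul_mem, Set.mem_ofPred_eq, Set.mem_ofPred_eq]
    nth_rw 1 [← inv_smul_eq_iff.2 (hw π hπ).symm]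
    rw [← smul_mul', ← Set.mem_smul_set_iff_inv_smul_mem, hS π hπ]

omit [MulAction (FinPerm 𝔸) X] in
-- Recognized languages are unions of fibers; fibers are themselves recognized, and surjectivity
-- makes them nonempty.
theorem atomicLanguages_recognizedBy {M : NomMonoid 𝔸} {e : FreeMonoid X → M}
    (hs : Function.Surjective e) :
    atomicLanguages (recognizedBy 𝔸 e) = Set.range fun m : M => e ⁻¹' {m} := by
  refine Set.Subset.antisymm ?_ ?_
  · rintro _ ⟨⟨⟨P, hP, rfl⟩, u, hu⟩, hmin⟩
    refine ⟨e u, ?_⟩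
    have hle : e ⁻¹' {e u} ⊆ e ⁻¹' P := by
      intro v hv
      rw [Set.mem_preimage, (show e v = e u from hv)]
      exact hu
    exact hle.antisymm (hmin ⟨fiber_mem_recognizedBy e (e u), u, rfl⟩ hle)
  · rintro _ ⟨m, rfl⟩
    obtain ⟨u, rfl⟩ := hs m
    refine ⟨⟨fiber_mem_recognizedBy e (e u), u, rfl⟩, ?_⟩
    rintro _ ⟨⟨P, hP, rfl⟩, v, hv⟩ hle w hw
    rw [Set.mem_preimage, (show e w = e u from hw), ← (show e v = e u from hle hv)]
    exact hv

theorem isAtomFinite_recognizedBy {M : NomMonoid 𝔸} (hM : IsOrbitFinite 𝔸 M)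
    {e : FreeMonoid X →* M} (he : Equivariant 𝔸 e) (hs : Function.Surjective e) :
    IsAtomFiniteLocalVariety 𝔸 (recognizedBy 𝔸 e) where
  isLocalVariety := isLocalVariety_recognizedBy hM he
  orbitFinite := by
    rw [atomicLanguages_recognizedBy hs, ← Set.image_univ]
    exact OrbitFiniteSet.image hM he.fiber
  exists_atomic := by
    rintro _ ⟨P, hP, rfl⟩ ⟨u, hu⟩
    refine ⟨e ⁻¹' {e u}, ?_, ?_⟩
    · rw [atomicLanguages_recognizedBy hs]
      exact ⟨e u, rfl⟩
    · intro v hv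
      rw [Set.mem_preimage, (show e v = e u from hv)]
      exact hu

end LocalVarieties

/-! ### Syntactic congruences and quotient monoids -/

section Quotients

variable {𝔸 : Type u}

/-- The quotient of a nominal monoid by an equivariant congruence. -/
def NomMonoid.quotient {Z : Type u} [Monoid Z] [MulDistribMulAction (FinPerm 𝔸) Z]
    (hZ : IsNominal 𝔸 Z) (c : Con Z) (hc : ∀ (π : FinPerm 𝔸) (u v : Z), c u v → c (π • u) (π • v)) :
    NomMonoid 𝔸 where
  carrier := c.Quotient
  action :=
    { smul := fun π => Quotient.map (π • ·) (hc π)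
      one_smul := by
        rintro ⟨u⟩
        exact congrArg (Quotient.mk _) (one_smul _ u)
      mul_smul := by
        rintro π ρ ⟨u⟩
        exact congrArg (Quotient.mk _) (mul_smul π ρ u)
      smul_mul := by
        rintro π ⟨u⟩ ⟨v⟩
        exact congrArg (Quotient.mk _) (smul_mul' π u v)
      smul_one := fun π => congrArg (Quotient.mk _) (smul_one π) }
  nominal := by
    rintro ⟨u⟩
    obtain ⟨S, hS⟩ := hZ u
    exact ⟨S, fun π hπ => congrArg (Quotient.mk _) (hS π hπ)⟩

/-- Every equivariant congruence is the kernel of a surjective equivariant morphism. -/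
theorem exists_quotient {Z : Type u} [Monoid Z] [MulDistribMulAction (FinPerm 𝔸) Z]
    (hZ : IsNominal 𝔸 Z) (c : Con Z)
    (hc : ∀ (π : FinPerm 𝔸) (u v : Z), c u v → c (π • u) (π • v)) :
    ∃ (N : NomMonoid 𝔸) (q : Z →* N), Equivariant 𝔸 q ∧ Function.Surjective q ∧
      ∀ u v, q u = q v ↔ c u v :=
  ⟨NomMonoid.quotient hZ c hc, c.mk', fun _ _ => rfl, Con.mk'_surjective, fun _ _ => c.eq⟩

/-- A morphism factors through every surjective morphism with a smaller kernel. -/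
theorem exists_factor {Z M N : Type u} [Monoid Z] [Monoid M] [Monoid N]
    [MulDistribMulAction (FinPerm 𝔸) Z] [MulDistribMulAction (FinPerm 𝔸) M]
    [MulDistribMulAction (FinPerm 𝔸) N] {p : Z →* M} {q : Z →* N} (hp : Equivariant 𝔸 p)
    (hq : Equivariant 𝔸 q) (hs : Function.Surjective p) (h : ∀ u v, p u = p v → q u = q v) :
    ∃ θ : M →* N, Equivariant 𝔸 θ ∧ ∀ u, θ (p u) = q u := by
  have hθ : ∀ u, q (hs (p u)).choose = q u := fun u => h _ _ (hs (p u)).choose_spec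
  refine ⟨{ toFun := fun m => q (hs m).choose, map_one' := ?_, map_mul' := ?_ }, ?_, hθ⟩
  · simpa using hθ 1
  · intro m n
    obtain ⟨u, rfl⟩ := hs m
    obtain ⟨v, rfl⟩ := hs n
    rw [← map_mul, hθ, hθ, hθ, map_mul]
  · intro π m
    obtain ⟨u, rfl⟩ := hs m
    change q (hs (π • p u)).choose = π • q (hs (p u)).choose
    rw [← hp, hθ, hθ, hq]

theorem FinitelySupported.mul {Z : Type u} [Monoid Z] [MulDistribMulAction (FinPerm 𝔸) Z] {x y : Z}
    (hx : FinitelySupported 𝔸 x) (hy : FinitelySupported 𝔸 y) : FinitelySupported 𝔸 (x * y) := by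
  obtain ⟨S, h1, h2⟩ := hx.common hy
  exact ⟨S, fun π hπ => by rw [smul_mul', h1 π hπ, h2 π hπ]⟩

variable {X : Type u} [MulAction (FinPerm 𝔸) X]

theorem equivariant_of : Equivariant 𝔸 (FreeMonoid.of : X → FreeMonoid X) := fun _ _ => rfl

theorem isNominal_freeMonoid (hX : IsNominal 𝔸 X) : IsNominal 𝔸 (FreeMonoid X) := fun w => by
  induction w using FreeMonoid.inductionOn with
  | one => exact finitelySupported_of_fixed fun π => smul_one π
  | of x => exact equivariant_of.finitelySupported (hX x)
  | mul x y hx hy => exact hx.mul hy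

theorem equivariant_lift {M : Type u} [Monoid M] [MulDistribMulAction (FinPerm 𝔸) M] {f : X → M}
    (hf : Equivariant 𝔸 f) : Equivariant 𝔸 (FreeMonoid.lift f) := fun π w => by
  induction w using FreeMonoid.inductionOn with
  | one => simp
  | of x => rw [← equivariant_of, FreeMonoid.lift_eval_of, FreeMonoid.lift_eval_of, hf]
  | mul x y hx hy => rw [smul_mul', map_mul, hx, hy, map_mul, smul_mul']

/-- The syntactic congruence of a set of languages. -/
def syntacticCon (D : Set (Set (FreeMonoid X))) : Con (FreeMonoid X) where
  r u v := ∀ K ∈ D, ∀ x y, x * u * y ∈ K ↔ x * v * y ∈ K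
  iseqv := ⟨fun _ _ _ _ _ => Iff.rfl, fun h K hK x y => (h K hK x y).symm,
    fun h h' K hK x y => (h K hK x y).trans (h' K hK x y)⟩
  mul' := by
    intro u v u' v' h h' K hK x y
    have h1 := h K hK x (u' * y)
    have h2 := h' K hK (x * v) y
    simp only [mul_assoc] at h1 h2 ⊢
    exact h1.trans h2

theorem syntacticCon_smul {D : Set (Set (FreeMonoid X))}
    (hD : ∀ (π : FinPerm 𝔸), ∀ K ∈ D, π • K ∈ D) (π : FinPerm 𝔸) (u v : FreeMonoid X)
    (h : syntacticCon D u v) : syntacticCon D (π • u) (π • v) := by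
  intro K hK x y
  have := h _ (hD π⁻¹ K hK) (π⁻¹ • x) (π⁻¹ • y)
  simpa only [Set.mem_smul_set_iff_inv_smul_mem, inv_inv, smul_mul', smul_inv_smul] using this

/-- Contexts can be dropped because they are absorbed by derivatives. -/
theorem IsLocalVariety.syntacticCon_iff {V : Set (Set (FreeMonoid X))} (hV : IsLocalVariety 𝔸 V)
    {u v : FreeMonoid X} : syntacticCon V u v ↔ ∀ K ∈ V, u ∈ K ↔ v ∈ K := by
  refine ⟨fun h K hK => by simpa using h K hK 1 1, fun h K hK x y => ?_⟩
  exact h _ (hV.leftDerivative_mem x _ (hV.rightDerivative_mem y _ hK))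

/-- Every atom-finite local variety consists of the languages recognized by a surjective morphism
into an orbit-finite nominal monoid. -/
theorem IsAtomFiniteLocalVariety.exists_eq_recognizedBy (hX : IsNominal 𝔸 X)
    {V : Set (Set (FreeMonoid X))} (hV : IsAtomFiniteLocalVariety 𝔸 V) :
    ∃ (N : NomMonoid 𝔸) (q : FreeMonoid X →* N), Equivariant 𝔸 q ∧ Function.Surjective q ∧
      IsOrbitFinite 𝔸 N ∧ V = recognizedBy 𝔸 q := by
  have lV := hV.isLocalVariety
  obtain ⟨N, q, hq, hs, hker⟩ := exists_quotient (isNominal_freeMonoid hX) (syntacticCon V)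
    (syntacticCon_smul lV.smul_mem)
  have hsub : atomicLanguages V ⊆ V := fun L hL => (mem_atomicLanguages.1 hL).1
  have hsmul : ∀ π : FinPerm 𝔸, ∀ L ∈ atomicLanguages V, π • L ∈ atomicLanguages V := by
    intro π L hL
    obtain ⟨hLV, hne, hmin⟩ := mem_atomicLanguages.1 hL
    refine mem_atomicLanguages.2 ⟨lV.smul_mem π L hLV, hne.smul_set, fun K hK hKne hKL => ?_⟩
    rw [Set.smul_set_subset_iff_subset_inv_smul_set]
    refine hmin _ (lV.smul_mem _ K hK) hKne.smul_set ?_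
    rwa [Set.smul_set_subset_iff_subset_inv_smul_set, inv_inv]
  -- The union of all atoms belongs to `V`; if its complement were nonempty, it would contain an
  -- atom.
  have hcover : ⋃₀ atomicLanguages V = Set.univ := by
    by_contra h
    have hU := lV.sUnion_mem hsub hV.orbitFinite ∅ fun ρ _ => hsmul ρ
    obtain ⟨K, hK, hKU⟩ := hV.exists_atomic _ (lV.compl_mem _ hU) (Set.nonempty_compl.2 h)
    obtain ⟨u, hu⟩ := (mem_atomicLanguages.1 hK).2.1
    exact hKU hu ⟨K, hK, hu⟩
  -- No `K ∈ V` separates two words of an atom `L`, since `L ∩ K` would be a smaller nonempty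
  -- member.
  have hfiber : ∀ L ∈ atomicLanguages V, ∀ u ∈ L, q ⁻¹' {q u} = L := by
    intro L hL u hu
    have hmin := (mem_atomicLanguages.1 hL).2.2
    ext v
    rw [Set.mem_preimage, Set.mem_singleton_iff, hker, lV.syntacticCon_iff]
    refine ⟨fun h => (h L (hsub hL)).2 hu, fun hv K hK => ⟨fun h => ?_, fun h => ?_⟩⟩
    · exact (hmin _ (lV.inter_mem L (hsub hL) K hK) ⟨v, hv, h⟩ Set.inter_subset_left hu).2
    · exact (hmin _ (lV.inter_mem L (hsub hL) K hK) ⟨u, hu, h⟩ Set.inter_subset_left hv).2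
  have hatom : ∀ n : N, q ⁻¹' {n} ∈ atomicLanguages V := by
    intro n
    obtain ⟨u, rfl⟩ := hs n
    obtain ⟨L, hL, hu⟩ : u ∈ ⋃₀ atomicLanguages V := hcover ▸ trivial
    rw [hfiber L hL u hu]
    exact hL
  have hN : IsOrbitFinite 𝔸 N := by
    refine OrbitFiniteSet.of_injective hq.fiber (fiber_injective hs) (hV.orbitFinite.mono ?_)
    rintro _ ⟨n, -, rfl⟩
    exact hatom n
  refine ⟨N, q, hq, hs, hN, Set.Subset.antisymm (fun L hL => ?_) ?_⟩
  · refine ⟨q '' L, hq.image.finitelySupported (lV.finitelySupported hL), ?_⟩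
    refine (Set.subset_preimage_image q L).antisymm ?_
    rintro u ⟨v, hv, e⟩
    exact (lV.syntacticCon_iff.1 ((hker _ _).1 e) L hL).1 hv
  · rintro _ ⟨P, hP, rfl⟩
    exact lV.preimage_mem hN hq (fun n => hsub (hatom n)) hP

end Quotients

end NomEil

namespace NomEil

/-! ### Support-reflecting covers and lifting -/

section StrongAlphabets

variable {𝔸 : Type u}

/-- Every orbit-finite nominal set is the image of an orbit-finite strong nominal set under a map
such that each element has a preimage with the same least support. -/
theorem exists_alphabet_cover [Infinite 𝔸] {M : Type u} [MulAction (FinPerm 𝔸) M]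
    (hM : IsOrbitFinite 𝔸 M) (hn : IsNominal 𝔸 M) : ∃ (B : Alphabet 𝔸) (g : B → M),
      Equivariant 𝔸 g ∧ ∀ m, ∃ b, g b = m ∧ supp 𝔸 b = supp 𝔸 m := by
  classical
  obtain ⟨R, hR, hrep⟩ := orbitFiniteSet_iff.1 hM
  choose S hS hsupp using fun m => exists_supp_eq (hn m)
  let H : R → Subgroup (FinPerm 𝔸) := fun r => fixingSubgroup (FinPerm 𝔸) (S r : Set 𝔸)
  have hH : ∀ (r : R) (π : FinPerm 𝔸), π ∈ H r ↔ ∀ a ∈ S r, π • a = a := fun r π =>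
    (mem_fixingSubgroup_iff _).trans Iff.rfl
  -- Each orbit of `M` is replaced by the cosets of the pointwise stabilizer of the least support of
  -- its representative. This keeps supports and makes the orbit strong.
  let B := Σ r : R, FinPerm 𝔸 ⧸ H r
  let mk : (r : R) → FinPerm 𝔸 → B := fun r π => ⟨r, (π : FinPerm 𝔸 ⧸ H r)⟩
  have hmk : ∀ b : B, ∃ r π, b = mk r π := by
    rintro ⟨r, x⟩
    obtain ⟨π, rfl⟩ := QuotientGroup.mk_surjective x
    exact ⟨r, π, rfl⟩
  have hsmul : ∀ r ρ π, ρ • mk r π = mk r (ρ * π) := fun r ρ π => rfl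
  have hmk_eq : ∀ r π ρ, mk r π = mk r ρ ↔ π⁻¹ * ρ ∈ H r := fun r π ρ =>
    (sigma_mk_injective (i := r)).eq_iff.trans QuotientGroup.eq
  have hstab : ∀ (r : R) (π ρ : FinPerm 𝔸),
      ρ • mk r π = mk r π ↔ ∀ a ∈ (S r).image (π • ·), ρ • a = a := by
    intro r π ρ
    rw [eq_comm, hsmul, hmk_eq, hH, Finset.forall_mem_image]
    refine forall₂_congr fun a _ => ?_
    rw [mul_smul, mul_smul, inv_smul_eq_iff]
  have hsuppB : ∀ r π, supp 𝔸 (mk r π) = (S r).image (π • ·) := fun r π =>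
    supp_eq_of_stabilizer (hstab r π)
  let g : B → M := fun b => Quotient.liftOn' b.2 (fun π => π • (b.1 : M)) (by
    intro π ρ h
    have h := (hH _ _).1 (QuotientGroup.leftRel_apply.1 h)
    have := hsupp (b.1 : M) (π⁻¹ * ρ) fun a ha => h a ha
    rw [mul_smul, inv_smul_eq_iff] at this
    exact this.symm)
  have hg : ∀ r π, g (mk r π) = π • (r : M) := fun r π => rfl
  have hge : Equivariant 𝔸 g := by
    intro ρ b
    obtain ⟨r, π, rfl⟩ := hmk b
    rw [hsmul, hg, hg, mul_smul]
  refine ⟨⟨B, ?_, ?_, ?_⟩, g, hge, ?_⟩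
  · intro b
    obtain ⟨r, π, rfl⟩ := hmk b
    exact ⟨(S r).image (π • ·), fun ρ hρ => (hstab r π ρ).2 fun a ha => hρ ha⟩
  · have := hR.to_subtype
    refine orbitFiniteSet_iff.2 ⟨Set.range fun r => mk r 1, Set.finite_range _, fun b _ => ?_⟩
    obtain ⟨r, π, rfl⟩ := hmk b
    exact ⟨_, ⟨r, rfl⟩, π, by rw [hsmul, mul_one]⟩
  · intro b ρ
    obtain ⟨r, π, rfl⟩ := hmk b
    rw [hsuppB, hstab]
    exact Iff.rfl
  · intro m
    obtain ⟨r, hr, π, rfl⟩ := hrep m trivial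
    refine ⟨mk ⟨r, hr⟩ π, rfl, Set.Subset.antisymm ?_ (hge.supp_subset (mk ⟨r, hr⟩ π))⟩
    rw [hsuppB]
    intro a ha T hT
    obtain ⟨s, hs, rfl⟩ := Finset.mem_image.1 (Finset.mem_coe.1 ha)
    have hsr : s ∈ supp 𝔸 r := hS r ▸ hs
    have h1 := supports_smul hT π⁻¹
    rw [inv_smul_smul] at h1
    obtain ⟨t, ht, rfl⟩ := Finset.mem_image.1 (hsr _ h1)
    simpa using ht

/-- Equivariant maps on a strong nominal set lift along equivariant maps that reflect supports. -/
theorem Alphabet.exists_lift [Infinite 𝔸] (A : Alphabet 𝔸) {Y N : Type u}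
    [MulAction (FinPerm 𝔸) Y] [MulAction (FinPerm 𝔸) N] (hY : IsNominal 𝔸 Y) {f : Y → N}
    (hf : Equivariant 𝔸 f) (hsr : ∀ n, ∃ y, f y = n ∧ supp 𝔸 y = supp 𝔸 n) {e : A → N}
    (he : Equivariant 𝔸 e) : ∃ k : A → Y, Equivariant 𝔸 k ∧ ∀ a, f (k a) = e a := by
  choose s hs hsupp using hsr
  let rep : A → A := fun a => (Quotient.mk (MulAction.orbitRel (FinPerm 𝔸) A) a).out
  have hrep : ∀ a, ∃ π : FinPerm 𝔸, π • rep a = a := fun a =>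
    MulAction.orbitRel_apply.1 (Quotient.exact (Quotient.out_eq _).symm)
  choose p hp using hrep
  have hrep_smul : ∀ (ρ : FinPerm 𝔸) a, rep (ρ • a) = rep a := fun ρ a =>
    congrArg Quotient.out (Quotient.sound (s := MulAction.orbitRel _ _) ⟨ρ, rfl⟩)
  -- Strongness enters here: a permutation fixing `r` fixes all of `supp r`, which contains `supp (e
  -- r)`, the support of the chosen preimage.
  have key : ∀ (σ τ : FinPerm 𝔸) (r : A), σ • r = τ • r → σ • s (e r) = τ • s (e r) := by
    intro σ τ r h
    rw [← inv_smul_eq_iff, ← mul_smul] at h ⊢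
    refine smul_eq_of_fixes_supp (hY _) fun a ha => ?_
    rw [hsupp] at ha
    exact (A.strong r _).1 h a (he.supp_subset r ha)
  refine ⟨fun a => p a • s (e (rep a)), fun ρ a => ?_, fun a => ?_⟩
  · change p (ρ • a) • s (e (rep (ρ • a))) = ρ • p a • s (e (rep a))
    rw [hrep_smul, ← mul_smul]
    refine key _ _ _ ?_
    rw [mul_smul, hp, ← hrep_smul ρ a, hp]
  · rw [hf, hs, ← he, hp]

theorem Alphabet.exists_lift_hom [Infinite 𝔸] (A B : Alphabet 𝔸) {N : NomMonoid 𝔸}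
    {f : FreeMonoid B →* N} (hf : Equivariant 𝔸 f)
    (hsr : ∀ n, ∃ w, f w = n ∧ supp 𝔸 w = supp 𝔸 n) {e : FreeMonoid A →* N}
    (he : Equivariant 𝔸 e) :
    ∃ k : FreeMonoid A →* FreeMonoid B, Equivariant 𝔸 k ∧ ∀ w, f (k w) = e w := by
  obtain ⟨k, hk, h⟩ := A.exists_lift (isNominal_freeMonoid B.nominal) hf hsr
    (he.comp equivariant_of)
  refine ⟨FreeMonoid.lift k, equivariant_lift hk, fun w => ?_⟩
  have : f.comp (FreeMonoid.lift k) = e := FreeMonoid.hom_eq fun a => by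
    rw [MonoidHom.comp_apply, FreeMonoid.lift_eval_of, h a]
    rfl
  exact DFunLike.congr_fun this w

/-- Every orbit-finite nominal monoid is the image of a free monoid over an orbit-finite strong
nominal set under a morphism that reflects supports. -/
theorem exists_freeMonoid_cover [Infinite 𝔸] (M : NomMonoid 𝔸) (hM : IsOrbitFinite 𝔸 M) :
    ∃ (B : Alphabet 𝔸) (g : FreeMonoid B →* M),
      Equivariant 𝔸 g ∧ ∀ m, ∃ w, g w = m ∧ supp 𝔸 w = supp 𝔸 m := by
  obtain ⟨B, g, hg, hsr⟩ := exists_alphabet_cover hM M.nominal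
  refine ⟨B, FreeMonoid.lift g, equivariant_lift hg, fun m => ?_⟩
  obtain ⟨b, rfl, h⟩ := hsr m
  exact ⟨FreeMonoid.of b, FreeMonoid.lift_eval_of g b,
    (equivariant_of.supp_eq FreeMonoid.of_injective b).trans h⟩

end StrongAlphabets

/-! ### From pseudovarieties to varieties -/

section PseudovarietyToVariety

variable {𝔸 : Type u} {X : Type u} [MulAction (FinPerm 𝔸) X]

/-- Every equivariant morphism factors into a surjective and an injective one. -/
theorem exists_image_factorization (hX : IsNominal 𝔸 X) {M : NomMonoid 𝔸}
    {e : FreeMonoid X →* M} (he : Equivariant 𝔸 e) :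
    ∃ (N : NomMonoid 𝔸) (p : FreeMonoid X →* N) (i : N →* M), Equivariant 𝔸 p ∧
      Function.Surjective p ∧ Equivariant 𝔸 i ∧ Function.Injective i ∧ ∀ u, i (p u) = e u := by
  obtain ⟨N, p, hp, hs, hker⟩ := exists_quotient (isNominal_freeMonoid hX) (Con.ker e)
    fun π u v h => by rw [Con.ker_rel] at *; rw [he, he, h]
  obtain ⟨i, hi, h⟩ := exists_factor hp he hs fun u v huv => (hker u v).1 huv
  refine ⟨N, p, i, hp, hs, hi, fun m n hmn => ?_, h⟩
  obtain ⟨u, rfl⟩ := hs m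
  obtain ⟨v, rfl⟩ := hs n
  rw [h, h] at hmn
  exact (hker u v).2 hmn

theorem IsOrbitFinite.of_injective {M N : Type u} [MulAction (FinPerm 𝔸) M]
    [MulAction (FinPerm 𝔸) N] (hM : IsOrbitFinite 𝔸 M) {i : N → M} (hi : Equivariant 𝔸 i)
    (h : Function.Injective i) : IsOrbitFinite 𝔸 N :=
  OrbitFiniteSet.of_injective hi h (hM.orbitFiniteSet _)

omit [MulAction (FinPerm 𝔸) X] in
theorem recognizedBy_mono {M N : NomMonoid 𝔸} {e : FreeMonoid X → M} {f : FreeMonoid X → N}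
    {θ : M → N} (hθ : Equivariant 𝔸 θ) (h : ∀ u, θ (e u) = f u) :
    recognizedBy 𝔸 f ⊆ recognizedBy 𝔸 e := by
  rintro _ ⟨P, hP, rfl⟩
  exact ⟨θ ⁻¹' P, hθ.preimage.finitelySupported hP, by ext u; simp [h]⟩

/-- Finitely many languages recognized by members of a pseudovariety are recognized by a common
morphism. -/
theorem Pseudovariety.exists_common (W : Pseudovariety 𝔸) {R : Set (Set (FreeMonoid X))}
    (hR : R.Finite) (h : ∀ L ∈ R, ∃ M ∈ W.members, M.Recognizes L) :
    ∃ M ∈ W.members, ∃ e : FreeMonoid X →* M, Equivariant 𝔸 e ∧ R ⊆ recognizedBy 𝔸 e := by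
  induction R, hR using Set.Finite.induction_on with
  | empty =>
    obtain ⟨M, hM⟩ := W.nonempty
    exact ⟨M, hM, 1, fun π u => (smul_one π).symm, Set.empty_subset _⟩
  | @insert L R _ _ ih =>
    obtain ⟨M, hM, e, he, hRe⟩ := ih fun K hK => h K (Set.mem_insert_of_mem _ hK)
    obtain ⟨N, hN, hL⟩ := h L (Set.mem_insert _ _)
    obtain ⟨f, hf, hLf⟩ := recognizes_iff.1 hL
    let k : FreeMonoid X →* M.prod N := MonoidHom.prod e f
    refine ⟨M.prod N, W.prod_mem M hM N hN, k, fun π u => Prod.ext (he π u) (hf π u),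
      Set.insert_subset ?_ (hRe.trans ?_)⟩
    · exact recognizedBy_mono (M := M.prod N) (θ := Prod.snd) (fun _ _ => rfl) (fun _ => rfl) hLf
    · exact recognizedBy_mono (M := M.prod N) (θ := Prod.fst) (fun _ _ => rfl) (fun _ => rfl)

/-- An orbit-finite nominal monoid lies in a pseudovariety if the fibers of some morphism onto it
are recognized by members. -/
theorem Pseudovariety.mem_of_recognizes (W : Pseudovariety 𝔸) (hX : IsNominal 𝔸 X)
    {M : NomMonoid 𝔸} (hM : IsOrbitFinite 𝔸 M) {g : FreeMonoid X →* M} (hg : Equivariant 𝔸 g)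
    (hs : Function.Surjective g) (h : ∀ m, ∃ N ∈ W.members, N.Recognizes (g ⁻¹' {m})) :
    M ∈ W.members := by
  obtain ⟨R, hR, hrep⟩ := orbitFiniteSet_iff.1 hM
  obtain ⟨N, hN, e, he, hRe⟩ := W.exists_common (hR.image fun m => g ⁻¹' {m}) (by
    rintro _ ⟨m, -, rfl⟩
    exact h m)
  obtain ⟨N', p, i, hp, hps, hi, hinj, hpi⟩ := exists_image_factorization hX he
  obtain ⟨θ, hθ, hθp⟩ := exists_factor hp hg hps (by
    intro u v huv
    obtain ⟨r, hr, π, hu⟩ := hrep (g u) trivial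
    obtain ⟨P, hP, hPe⟩ := hRe ⟨r, hr, rfl⟩
    -- Recognizing one fiber per orbit suffices, since the other fibers are translates and `e` is
    -- equivariant. Hence the kernel of `e` refines that of `g`.
    have hfib : g ⁻¹' {g u} = e ⁻¹' (π • P) := by
      rw [he.preimage_smul, ← hPe, ← hu]
      exact hg.fiber π r
    have h1 : e u ∈ π • P := hfib.subset (rfl : g u = g u)
    rw [← hpi, huv, hpi] at h1
    exact (hfib.superset h1 : g v = g u).symm)
  refine W.quotient_mem _ (W.submonoid_mem N hN N' i hi hinj) M θ hθ fun m => ?_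
  obtain ⟨u, rfl⟩ := hs m
  exact ⟨p u, hθp u⟩

/-- Every closure condition involves at most two languages, and these lie in the local variety of a
common morphism into one member. -/
theorem Pseudovariety.isLocalVariety (W : Pseudovariety 𝔸) :
    IsLocalVariety 𝔸 {L : Set (FreeMonoid X) | ∃ M ∈ W.members, M.Recognizes L} := by
  have aux : ∀ R : Set (Set (FreeMonoid X)), R.Finite →
      R ⊆ {L : Set (FreeMonoid X) | ∃ M ∈ W.members, M.Recognizes L} →
      ∃ V, IsLocalVariety 𝔸 V ∧ R ⊆ V ∧
        V ⊆ {L : Set (FreeMonoid X) | ∃ M ∈ W.members, M.Recognizes L} := by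
    intro R hR h
    obtain ⟨M, hM, e, he, hRe⟩ := W.exists_common hR h
    exact ⟨_, isLocalVariety_recognizedBy (W.orbitFinite M hM) he, hRe,
      fun L hL => ⟨M, hM, recognizes_of_mem he hL⟩⟩
  have aux0 := aux ∅ Set.finite_empty (Set.empty_subset _)
  have aux1 := fun L hL => aux {L} (Set.finite_singleton L) (Set.singleton_subset_iff.2 hL)
  have aux2 := fun K hK L hL => aux {K, L} (Set.toFinite _) (Set.pair_subset hK hL)
  constructor
  · rintro L ⟨M, hM, hL⟩
    exact ⟨M, W.orbitFinite M hM, hL⟩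
  · intro π L hL
    obtain ⟨V, hV, h, hVW⟩ := aux1 L hL
    exact hVW (hV.smul_mem π L (h rfl))
  · obtain ⟨V, hV, -, hVW⟩ := aux0
    exact hVW hV.empty_mem
  · obtain ⟨V, hV, -, hVW⟩ := aux0
    exact hVW hV.univ_mem
  · intro K hK L hL
    obtain ⟨V, hV, h, hVW⟩ := aux2 K hK L hL
    exact hVW (hV.union_mem K (h (Or.inl rfl)) L (h (Or.inr rfl)))
  · intro K hK L hL
    obtain ⟨V, hV, h, hVW⟩ := aux2 K hK L hL
    exact hVW (hV.inter_mem K (h (Or.inl rfl)) L (h (Or.inr rfl)))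
  · intro L hL
    obtain ⟨V, hV, h, hVW⟩ := aux1 L hL
    exact hVW (hV.compl_mem L (h rfl))
  · intro S L hL
    obtain ⟨V, hV, h, hVW⟩ := aux1 L hL
    exact hVW (hV.orbitUnion_mem S L (h rfl))
  · intro w L hL
    obtain ⟨V, hV, h, hVW⟩ := aux1 L hL
    exact hVW (hV.leftDerivative_mem w L (h rfl))
  · intro w L hL
    obtain ⟨V, hV, h, hVW⟩ := aux1 L hL
    exact hVW (hV.rightDerivative_mem w L (h rfl))

/-- The variety of data languages recognized by the members of a pseudovariety. -/
def Pseudovariety.toVariety [Infinite 𝔸] (W : Pseudovariety 𝔸) : Variety 𝔸 where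
  lang A := {L | ∃ M ∈ W.members, M.Recognizes L}
  isLocalVariety A := W.isLocalVariety
  preimage_mem := by
    rintro B A h hh L ⟨M, hM, hL, e, he, P, hP, rfl⟩
    exact ⟨M, hM, hh.preimage.finitelySupported hL, e.comp h, he.comp hh, P, hP, rfl⟩
  complete := by
    intro A V' hV' hV'W
    obtain ⟨M, e, he, hs, hM, rfl⟩ := hV'.exists_eq_recognizedBy A.nominal
    have hMW : M ∈ W.members := W.mem_of_recognizes A.nominal hM he hs fun m =>
      hV'W (fiber_mem_recognizedBy e m)
    obtain ⟨B, g, hg, hsr⟩ := exists_freeMonoid_cover M hM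
    -- The morphism required by completeness is a lift of `e` along the cover `g`, and the local
    -- variety over `B` consists of the languages recognized by `g`.
    obtain ⟨h, hh, hgh⟩ := A.exists_lift_hom B hg hsr he
    have hgs : Function.Surjective g := fun m => (hsr m).imp fun _ hw => hw.1
    have hpre : ∀ P : Set M, h ⁻¹' (g ⁻¹' P) = e ⁻¹' P := fun P => by
      ext u
      simp [hgh]
    refine ⟨B, h, recognizedBy 𝔸 g, hh, isAtomFinite_recognizedBy hM hg hgs,
      fun L hL => ⟨M, hMW, recognizes_of_mem hg hL⟩, ⟨?_, ?_, ?_⟩, ?_⟩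
    · rintro _ ⟨P, hP, rfl⟩
      exact ⟨P, hP, hpre P⟩
    · rintro _ ⟨P, hP, rfl⟩ _ ⟨Q, hQ, rfl⟩ hPQ
      have hPQ : h ⁻¹' (g ⁻¹' P) = h ⁻¹' (g ⁻¹' Q) := hPQ
      rw [hpre, hpre] at hPQ
      rw [hs.preimage_injective hPQ]
    · rintro _ ⟨P, hP, rfl⟩
      exact ⟨g ⁻¹' P, ⟨P, hP, rfl⟩, hpre P⟩
    · rw [atomicLanguages_recognizedBy hgs]
      rintro _ ⟨m, rfl⟩
      obtain ⟨w, hw, hsupp⟩ := hsr m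
      exact ⟨w, hw, (hg.fiber.supp_eq (fiber_injective hgs) m).trans hsupp.symm⟩

end PseudovarietyToVariety

end NomEil

namespace NomEil

/-! ### From varieties to pseudovarieties -/

section VarietyToPseudovariety

variable {𝔸 : Type u}

/-- If a variety contains all languages recognized by some morphism onto an orbit-finite nominal
monoid, then it contains all languages recognized by that monoid. -/
theorem Variety.mem_of_recognizes [Infinite 𝔸] (V : Variety 𝔸) {A : Alphabet 𝔸} {N : NomMonoid 𝔸}
    (hN : IsOrbitFinite 𝔸 N) {q : FreeMonoid A →* N} (hq : Equivariant 𝔸 q)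
    (hs : Function.Surjective q) (hV : recognizedBy 𝔸 q ⊆ V.lang A) (A' : Alphabet 𝔸)
    (L : Set (FreeMonoid A')) (hL : N.Recognizes L) : L ∈ V.lang A' := by
  obtain ⟨B, h, W', hh, hW', hWV, hbij, hat⟩ :=
    V.complete A _ (isAtomFinite_recognizedBy hN hq hs) hV
  obtain ⟨N', q', hq', hs', hN', rfl⟩ := hW'.exists_eq_recognizedBy B.nominal
  -- Both families contain the fibers of their morphism, so the bijection of languages forces equal
  -- kernels.
  have hker : ∀ u v, q' (h u) = q' (h v) ↔ q u = q v := by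
    intro u v
    constructor
    · intro huv
      obtain ⟨_, ⟨P, hP, rfl⟩, e⟩ := hbij.surjOn (fiber_mem_recognizedBy q (q u))
      have e : h ⁻¹' (q' ⁻¹' P) = q ⁻¹' {q u} := e
      have hu : q' (h u) ∈ P := e.superset (rfl : q u = q u)
      rw [huv] at hu
      exact (e.subset hu : q v = q u).symm
    · intro huv
      obtain ⟨P, hP, e⟩ := hbij.mapsTo (fiber_mem_recognizedBy q' (q' (h u)))
      have e : h ⁻¹' (q' ⁻¹' {q' (h u)}) = q ⁻¹' P := e
      have hu : q u ∈ P := e.subset (rfl : q' (h u) = q' (h u))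
      rw [huv] at hu
      exact (e.superset hu : q' (h v) = q' (h u)).symm
  have hsurj : Function.Surjective (q'.comp h) := by
    intro n
    by_contra hn
    have hn : ∀ u, q' (h u) ≠ n := fun u hu => hn ⟨u, hu⟩
    -- A missed fiber would have the same preimage as `∅`, contradicting injectivity on languages.
    have e : h ⁻¹' (q' ⁻¹' {n}) = h ⁻¹' ∅ := by
      ext u
      simpa using hn u
    have h0 := hbij.injOn (fiber_mem_recognizedBy q' n) hW'.isLocalVariety.empty_mem e
    obtain ⟨w, hw⟩ := hs' n
    exact h0.subset hw
  obtain ⟨θ, hθ, hθq⟩ := exists_factor (hq'.comp hh : Equivariant 𝔸 (q'.comp h)) hq hsurj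
    fun u v => (hker u v).1
  have hθinj : Function.Injective θ := by
    intro m n hmn
    obtain ⟨u, rfl⟩ := hsurj m
    obtain ⟨v, rfl⟩ := hsurj n
    rw [hθq, hθq] at hmn
    exact (hker u v).2 hmn
  have hf : Equivariant 𝔸 (θ.comp q') := hθ.comp hq'
  -- The support condition on atoms says that `q'` reflects supports, and the injective `θ`
  -- preserves them.
  have hsr : ∀ n, ∃ w, (θ.comp q') w = n ∧ supp 𝔸 w = supp 𝔸 n := by
    intro n
    obtain ⟨u, rfl⟩ := hs n
    rw [← hθq, hθ.supp_eq hθinj]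
    obtain ⟨w, hw, e⟩ := hat (q' ⁻¹' {q' (h u)}) (by
      rw [atomicLanguages_recognizedBy hs']
      exact ⟨_, rfl⟩)
    refine ⟨w, congrArg θ hw, ?_⟩
    rw [← e]
    exact hq'.fiber.supp_eq (fiber_injective hs') _
  obtain ⟨-, e, he, P, hP, rfl⟩ := hL
  obtain ⟨k, hk, hke⟩ := A'.exists_lift_hom B hf hsr he
  have := V.preimage_mem A' B k hk _
    (hWV ⟨θ ⁻¹' P, hθ.preimage.finitelySupported hP, rfl⟩)
  convert this using 1
  ext u
  simp [← hke]

variable (𝔸) in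
/-- The one-element nominal monoid. -/
def NomMonoid.trivial : NomMonoid 𝔸 where
  carrier := PUnit
  nominal := fun _ => finitelySupported_of_fixed fun _ => rfl

theorem isOrbitFinite_trivial : IsOrbitFinite 𝔸 (NomMonoid.trivial 𝔸) :=
  orbitFiniteSet_iff.2 ⟨{PUnit.unit}, Set.finite_singleton _, fun _ _ => ⟨_, rfl, 1, rfl⟩⟩

theorem IsOrbitFinite.nomMonoid_prod {M N : NomMonoid 𝔸} (hM : IsOrbitFinite 𝔸 M)
    (hN : IsOrbitFinite 𝔸 N) : IsOrbitFinite 𝔸 (M.prod N) :=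
  IsOrbitFinite.prod hM hN M.nominal N.nominal

/-- The pseudovariety of the orbit-finite nominal monoids that recognize only languages of a
given variety. -/
def Variety.toPseudovariety [Infinite 𝔸] (V : Variety 𝔸) : Pseudovariety 𝔸 where
  members := {M | IsOrbitFinite 𝔸 M ∧ ∀ (A : Alphabet 𝔸) (L : Set (FreeMonoid A)),
    M.Recognizes L → L ∈ V.lang A}
  orbitFinite M hM := hM.1
  nonempty := by
    refine ⟨NomMonoid.trivial 𝔸, isOrbitFinite_trivial, ?_⟩
    rintro A _ ⟨-, e, he, P, hP, rfl⟩
    by_cases h : PUnit.unit ∈ P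
    · convert (V.isLocalVariety A).univ_mem
      exact Set.eq_univ_of_forall fun u => h
    · convert (V.isLocalVariety A).empty_mem
      exact Set.eq_empty_of_forall_notMem fun u hu => h hu
  prod_mem := by
    rintro M ⟨hM, hMV⟩ N ⟨hN, hNV⟩
    refine ⟨hM.nomMonoid_prod hN, ?_⟩
    rintro A _ ⟨-, e, he, P, hP, rfl⟩
    have lV := V.isLocalVariety A
    refine lV.preimage_mem (hM.nomMonoid_prod hN) he ?_ hP
    intro x
    let e₁ : FreeMonoid A →* M := (MonoidHom.fst M N).comp e
    let e₂ : FreeMonoid A →* N := (MonoidHom.snd M N).comp e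
    have h₁ : Equivariant 𝔸 e₁ := fun π u => congrArg Prod.fst (he π u)
    have h₂ : Equivariant 𝔸 e₂ := fun π u => congrArg Prod.snd (he π u)
    have eq : e ⁻¹' {x} = e₁ ⁻¹' {Prod.fst x} ∩ e₂ ⁻¹' {Prod.snd x} := by
      ext u
      exact Prod.ext_iff
    rw [eq]
    exact lV.inter_mem _ (hMV A _ (recognizes_of_mem h₁ (fiber_mem_recognizedBy e₁ _)))
      _ (hNV A _ (recognizes_of_mem h₂ (fiber_mem_recognizedBy e₂ _)))
  submonoid_mem := by
    rintro M ⟨hM, hMV⟩ N i hi hinj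
    refine ⟨hM.of_injective hi hinj, ?_⟩
    rintro A L ⟨hL, e, he, P, hP, rfl⟩
    refine hMV A _ ⟨hL, i.comp e, hi.comp he, i '' P, hi.image.finitelySupported hP, ?_⟩
    ext u
    simp [hinj.eq_iff]
  quotient_mem := by
    rintro M ⟨hM, hMV⟩ N q hq hs
    have hN := hM.of_surjective hq hs
    -- A morphism into `N` need not lift to `M`. Instead, the languages of the composite `q.comp g`
    -- are recognized by `M`, and completeness spreads membership to all languages recognized by
    -- `N`.
    obtain ⟨B, g, hg, hsr⟩ := exists_freeMonoid_cover M hM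
    have hqg : Equivariant 𝔸 (q.comp g) := hq.comp hg
    refine ⟨hN, V.mem_of_recognizes hN hqg ?_ fun L hL => hMV B L ?_⟩
    · exact hs.comp fun m => (hsr m).imp fun _ hw => hw.1
    · exact recognizes_of_mem hg (recognizedBy_mono hq (fun u => rfl) hL)

/-- Every language in a variety is recognized by an orbit-finite nominal monoid that recognizes
only languages of the variety. -/
theorem Variety.exists_recognizes [Infinite 𝔸] (V : Variety 𝔸) {A : Alphabet 𝔸}
    {L : Set (FreeMonoid A)} (hL : L ∈ V.lang A) :
    ∃ M ∈ V.toPseudovariety.members, M.Recognizes L := by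
  have lV := V.isLocalVariety A
  obtain ⟨M₀, hM₀, -, e, he, P₀, hP₀, rfl⟩ := lV.recognizable L hL
  obtain ⟨M, p, i, hp, hps, hi, hinj, hpi⟩ := exists_image_factorization A.nominal he
  have hM := hM₀.of_injective hi hinj
  obtain ⟨P, hP, hLP⟩ : e ⁻¹' P₀ ∈ recognizedBy 𝔸 p := recognizedBy_mono hi hpi ⟨P₀, hP₀, rfl⟩
  rw [hLP] at hL ⊢
  -- These are the two-sided derivatives of the translates of the language. `M` itself may recognize
  -- languages outside the variety, so it is replaced by the quotient that these sets determine.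
  let E : M → M → FinPerm 𝔸 → Set (FreeMonoid A) := fun m n π => {v | m * p v * n ∈ π • P}
  have hE : ∀ (ρ : FinPerm 𝔸) m n π, ρ • E m n π = E (ρ • m) (ρ • n) (ρ * π) := by
    intro ρ m n π
    ext v
    simp only [E, Set.mem_smul_set_iff_inv_smul_mem, Set.mem_ofPred_eq, hp ρ⁻¹, smul_mul',
      inv_smul_smul, mul_inv_rev, mul_smul]
  let D : Set (Set (FreeMonoid A)) := {K | ∃ m n π, K = E m n π}
  have hDsmul : ∀ (ρ : FinPerm 𝔸), ∀ K ∈ D, ρ • K ∈ D := by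
    rintro ρ _ ⟨m, n, π, rfl⟩
    exact ⟨_, _, _, hE ρ m n π⟩
  have hDV : D ⊆ V.lang A := by
    rintro _ ⟨m, n, π, rfl⟩
    obtain ⟨x, rfl⟩ := hps m
    obtain ⟨y, rfl⟩ := hps n
    have := lV.leftDerivative_mem x _ (lV.rightDerivative_mem y _ (lV.smul_mem π _ hL))
    convert this using 1
    ext v
    simp [E, ← hp.preimage_smul]
  -- Translation reduces to `π = 1`; the remaining pairs in `M × M` matter only up to permutations
  -- fixing a support of `P`.
  have hDfin : OrbitFiniteSet 𝔸 D := by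
    obtain ⟨S, hS⟩ := hP
    obtain ⟨R, -, hR, hrep⟩ := OrbitFiniteSet.exists_finite_reps
      (hM.prod hM M.nominal M.nominal) (fun x _ => (M.prod M).nominal x) S
    refine orbitFiniteSet_iff.2 ⟨(fun x => E x.1 x.2 1) '' R, hR.image _, ?_⟩
    rintro _ ⟨m, n, π, rfl⟩
    obtain ⟨⟨r, s⟩, hr, ρ, hρ, hx⟩ := hrep (π⁻¹ • m, π⁻¹ • n) ⟨⟩
    obtain ⟨h1, h2⟩ := Prod.ext_iff.1 hx
    have h1 : ρ • r = π⁻¹ • m := h1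
    have h2 : ρ • s = π⁻¹ • n := h2
    refine ⟨_, ⟨_, hr, rfl⟩, π * ρ, ?_⟩
    rw [hE, mul_smul, mul_smul, h1, h2, smul_inv_smul, smul_inv_smul, mul_one]
    simp only [E, mul_smul, hS ρ fun a ha => hρ a ha]
  have hcon : ∀ u v, syntacticCon D u v ↔ ∀ K ∈ D, u ∈ K ↔ v ∈ K := by
    refine fun u v => ⟨fun h K hK => by simpa using h K hK 1 1, ?_⟩
    rintro h _ ⟨m, n, π, rfl⟩ x y
    simpa [E, mul_assoc] using h _ ⟨m * p x, p y * n, π, rfl⟩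
  obtain ⟨N, q, hq, hqs, hker⟩ := exists_quotient (isNominal_freeMonoid A.nominal)
    (syntacticCon D) (syntacticCon_smul hDsmul)
  have hN : IsOrbitFinite 𝔸 N := by
    obtain ⟨θ, hθ, hθp⟩ := exists_factor hp hq hps (by
      intro u v huv
      rw [hker, hcon]
      rintro _ ⟨m, n, π, rfl⟩
      simp [E, huv])
    exact hM.of_surjective hθ fun n => (hqs n).elim fun u hu => ⟨p u, (hθp u).trans hu⟩
  have hfiber : ∀ n, q ⁻¹' {n} ∈ V.lang A := by
    intro n
    obtain ⟨u, rfl⟩ := hqs n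
    obtain ⟨S, hS⟩ := isNominal_freeMonoid A.nominal u
    -- The fiber of `u` would be an infinite intersection of members and complements of members of
    -- `D`. Dually, its complement is the union of those avoiding `u`, an orbit-finite family
    -- supported by any support of `u`.
    let T : Set (Set (FreeMonoid A)) := {K | K ∈ D ∪ compl '' D ∧ u ∉ K}
    have hTV : T ⊆ V.lang A := by
      rintro K ⟨hK | ⟨K, hK, rfl⟩, -⟩
      · exact hDV hK
      · exact lV.compl_mem K (hDV hK)
    have hT : ⋃₀ T ∈ V.lang A := by
      refine lV.sUnion_mem hTV ?_ S ?_
      · exact (hDfin.union (hDfin.image fun π K => Set.smul_set_compl.symm)).mono fun K hK => hK.1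
      · rintro ρ hρ K ⟨hK, hu⟩
        refine ⟨?_, ?_⟩
        · rcases hK with hK | ⟨K, hK, rfl⟩
          · exact Or.inl (hDsmul ρ K hK)
          · exact Or.inr ⟨ρ • K, hDsmul ρ K hK, Set.smul_set_compl.symm⟩
        · rw [← hS ρ fun a ha => hρ a ha, Set.smul_mem_smul_set_iff]
          exact hu
    have eq : q ⁻¹' {q u} = (⋃₀ T)ᶜ := by
      ext v
      rw [Set.mem_preimage, Set.mem_singleton_iff, hker, hcon, Set.mem_compl_iff]
      constructor
      · rintro h ⟨K, ⟨hK | ⟨K, hK, rfl⟩, hu⟩, hv⟩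
        · exact hu ((h K hK).1 hv)
        · exact hu fun hu => hv ((h K hK).2 hu)
      · intro h K hK
        constructor
        · intro hv
          by_contra hu
          exact h ⟨K, ⟨Or.inl hK, hu⟩, hv⟩
        · intro hu
          by_contra hv
          exact h ⟨Kᶜ, ⟨Or.inr ⟨K, hK, rfl⟩, fun h => h hu⟩, hv⟩
    rw [eq]
    exact lV.compl_mem _ hT
  have hqV : recognizedBy 𝔸 q ⊆ V.lang A := by
    rintro _ ⟨Q, hQ, rfl⟩
    exact lV.preimage_mem hN hq hfiber hQ
  refine ⟨N, ⟨hN, V.mem_of_recognizes hN hq hqs hqV⟩, recognizes_of_mem hq ⟨q '' (p ⁻¹' P),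
    hq.image.finitelySupported (hp.preimage.finitelySupported hP), ?_⟩⟩
  refine (Set.subset_preimage_image q _).antisymm ?_
  rintro u ⟨v, hv, huv⟩
  have := (hcon v u).1 ((hker _ _).1 huv) _ ⟨1, 1, 1, rfl⟩
  simp only [E, one_mul, mul_one, one_smul, Set.mem_ofPred_eq] at this
  exact this.1 hv

end VarietyToPseudovariety

/-! ### The order isomorphism -/

section EilenbergCorrespondence

variable {𝔸 : Type u} [Infinite 𝔸]

theorem Variety.toVariety_toPseudovariety (V : Variety 𝔸) : V.toPseudovariety.toVariety = V := by
  refine Variety.ext (funext fun A => Set.Subset.antisymm ?_ fun L hL => V.exists_recognizes hL)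
  rintro L ⟨M, hM, hL⟩
  exact hM.2 A L hL

theorem Pseudovariety.toPseudovariety_toVariety (W : Pseudovariety 𝔸) :
    W.toVariety.toPseudovariety = W := by
  refine Pseudovariety.ext (Set.Subset.antisymm ?_ fun M hM =>
    ⟨W.orbitFinite M hM, fun A L hL => ⟨M, hM, hL⟩⟩)
  rintro M ⟨hM, h⟩
  obtain ⟨B, g, hg, hsr⟩ := exists_freeMonoid_cover M hM
  exact W.mem_of_recognizes B.nominal hM hg (fun m => (hsr m).imp fun _ hw => hw.1) fun m =>
    h B _ (recognizes_of_mem hg (fiber_mem_recognizedBy g m))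

variable (𝔸) in
/-- The isomorphism between varieties of data languages and pseudovarieties of nominal monoids. -/
def eilenbergIso : Variety 𝔸 ≃o Pseudovariety 𝔸 where
  toFun := Variety.toPseudovariety
  invFun := Pseudovariety.toVariety
  left_inv := Variety.toVariety_toPseudovariety
  right_inv := Pseudovariety.toPseudovariety_toVariety
  map_rel_iff' := by
    intro V V'
    constructor
    · intro h A L hL
      obtain ⟨M, hM, hML⟩ := V.exists_recognizes hL
      exact (h hM).2 A L hML
    · intro h M hM
      exact ⟨hM.1, fun A L hL => h A (hM.2 A L hL)⟩

end EilenbergCorrespondence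

/-! ### Completeness of both lattices -/

section CompleteLattices

variable {𝔸 : Type u}

theorem Pseudovariety.trivial_mem (W : Pseudovariety 𝔸) : NomMonoid.trivial 𝔸 ∈ W.members := by
  obtain ⟨M, hM⟩ := W.nonempty
  exact W.quotient_mem M hM (NomMonoid.trivial 𝔸) 1 (fun _ _ => rfl) fun _ => ⟨1, rfl⟩

/-- The intersection of a set of pseudovarieties. -/
def Pseudovariety.inter (S : Set (Pseudovariety 𝔸)) : Pseudovariety 𝔸 where
  -- Orbit-finiteness is stated separately for the sake of empty `S`, which yields the largest
  -- pseudovariety.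
  members := {M | IsOrbitFinite 𝔸 M ∧ ∀ W ∈ S, M ∈ W.members}
  orbitFinite _ hM := hM.1
  nonempty := ⟨NomMonoid.trivial 𝔸, isOrbitFinite_trivial, fun W _ => W.trivial_mem⟩
  prod_mem M hM N hN := ⟨hM.1.nomMonoid_prod hN.1,
    fun W hW => W.prod_mem M (hM.2 W hW) N (hN.2 W hW)⟩
  submonoid_mem M hM N i hi hinj := ⟨hM.1.of_injective hi hinj,
    fun W hW => W.submonoid_mem M (hM.2 W hW) N i hi hinj⟩
  quotient_mem M hM N q hq hs := ⟨hM.1.of_surjective hq hs,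
    fun W hW => W.quotient_mem M (hM.2 W hW) N q hq hs⟩

theorem Pseudovariety.isGLB_inter (S : Set (Pseudovariety 𝔸)) : IsGLB S (inter S) :=
  ⟨fun W hW _ hM => hM.2 W hW, fun W hW M hM => ⟨W.orbitFinite M hM, fun _ hW' => hW hW' hM⟩⟩

/-- Infima are intersections, and a supremum is the infimum of all upper bounds. -/
theorem isCompleteLattice_pseudovariety : IsCompleteLattice (Pseudovariety 𝔸) := fun S =>
  ⟨⟨_, isGLB_upperBounds.1 (Pseudovariety.isGLB_inter (upperBounds S))⟩,
    _, Pseudovariety.isGLB_inter S⟩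

theorem IsCompleteLattice.of_orderIso {P Q : Type*} [PartialOrder P] [PartialOrder Q]
    (hQ : IsCompleteLattice Q) (f : P ≃o Q) : IsCompleteLattice P := fun S => by
  obtain ⟨⟨a, ha⟩, b, hb⟩ := hQ (f '' S)
  exact ⟨⟨_, f.isLUB_image.1 ha⟩, _, f.isGLB_image.1 hb⟩

end CompleteLattices

end NomEil

theorem mainTheorem1 (𝔸 : Type u) [Countable 𝔸] [Infinite 𝔸] :
    NomEil.IsCompleteLattice (NomEil.Variety 𝔸) ∧
    NomEil.IsCompleteLattice (NomEil.Pseudovariety 𝔸) ∧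
    ∃ φ : NomEil.Variety 𝔸 ≃o NomEil.Pseudovariety 𝔸,
      (∀ V : NomEil.Variety 𝔸, (φ V).members =
        {M : NomEil.NomMonoid 𝔸 | NomEil.IsOrbitFinite 𝔸 M ∧
          ∀ (A : NomEil.Alphabet 𝔸) (L : Set (FreeMonoid A)),
            M.Recognizes L → L ∈ V.lang A}) ∧
      (∀ (W : NomEil.Pseudovariety 𝔸) (A : NomEil.Alphabet 𝔸), (φ.symm W).lang A =
        {L : Set (FreeMonoid A) | ∃ M ∈ W.members, M.Recognizes L}) :=
  ⟨NomEil.isCompleteLattice_pseudovariety.of_orderIso (NomEil.eilenbergIso 𝔸),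
    NomEil.isCompleteLattice_pseudovariety, NomEil.eilenbergIso 𝔸, fun _ => rfl, fun _ _ => rfl⟩
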